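/- All monoids are commutative and cancellative, written additively when they serve as exponents. A monoid $M$ is torsion-free if $na=nb$ with $a,b\in M$ and $n$ a positive integer implies $a=b$; $\mathrm{gp}(M)$ is its quotient group, and $R[M]$ is the monoid ring of $M$ over $R$. For a monoid $H$ with group of units $U(H)$ and $b\in H$, let $Z(b)$ be the set of formal commutative products of irreducibles of $H/U(H)$ whose product in $H/U(H)$ is the class of $b$, and let $L(b)$ be the set of lengths (numbers of factors, with repetition) of the elements of $Z(b)$. $H$ is a BFM (resp. FFM) if every non-invertible element of $H$ is a finite product of irreducibles and $L(b)$ (resp. $Z(b)$) is finite for every $b\in H$. An integral domain $R$ is a BFD (resp. FFD) if the multiplicative monoid $R\setminus\{0\}$ is a BFM (resp. FFM). A nonzero element $b$ of an abelian group has type $(0,0,\dots)$ if there is a largest positive integer $n$ such that $nx=b$ is solvable in the group. Theorem. Let $R$ be an integral domain, $F$ a field, $G$ a torsion-free abelian group all of whose nonzero elements have type $(0,0,\dots)$, and $M$ a torsion-free monoid such that all nonzero elements of $\mathrm{gp}(M)$ have type $(0,0,\dots)$. Then: 1. $R[G]$ is a BFD if and only if $R$ is a BFD. 2. $F[M]$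 is a BFD if and only if $M$ is a BFM. 3. $R[M]$ is a BFD if and only if $R$ is a BFD and $M$ is a BFM. 4. $R[G]$ is an FFD if and only if $R$ is an FFD. 5. $F[M]$ is an FFD if and only if $M$ is an FFM. 6. $R[M]$ is an FFD if and only if $R$ is an FFD and $M$ is an FFM. -/

import Mathlib

namespace FactorizationTheory

/-- A commutative monoid is atomic if every non-invertible element is a finite product of
irreducibles. -/
def IsAtomicMonoid (M : Type*) [CommMonoid M] : Prop :=
  ∀ b : M, ¬ IsUnit b → ∃ s : Multiset M, (∀ a ∈ s, Irreducible a) ∧ s.prod = b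

/-- The set `Z(b)` of factorizations of `b`: the formal commutative products (multisets) of
irreducibles of the reduced monoid `M / U(M)` whose product there is the class of `b`.
For a commutative monoid, `Associates M` is the quotient `M / U(M)`. -/
def factorizationSet {M : Type*} [CommMonoid M] (b : M) : Set (Multiset (Associates M)) :=
  {z | (∀ a ∈ z, Irreducible a) ∧ z.prod = Associates.mk b}

/-- The set `L(b)` of lengths of factorizations of `b`. -/
def lengthSet {M : Type*} [CommMonoid M] (b : M) : Set ℕ :=
  Multiset.card '' factorizationSet b

/-- Bounded factorization monoid. -/
def IsBFM (M : Type*) [CommMonoid M] : Prop :=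
  IsAtomicMonoid M ∧ ∀ b : M, (lengthSet b).Finite

/-- Finite factorization monoid. -/
def IsFFM (M : Type*) [CommMonoid M] : Prop :=
  IsAtomicMonoid M ∧ ∀ b : M, (factorizationSet b).Finite

/-- Bounded factorization domain: an integral domain whose multiplicative monoid of nonzero
elements is a bounded factorization monoid (in a domain the non-zero-divisors are exactly the
nonzero elements). -/
def IsBFD (R : Type*) [CommRing R] : Prop :=
  IsDomain R ∧ IsBFM (nonZeroDivisors R)

/-- Finite factorization domain. -/
def IsFFD (R : Type*) [CommRing R] : Prop :=
  IsDomain R ∧ IsFFM (nonZeroDivisors R)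

/-- An element `b` of an abelian group has type `(0, 0, …)` if there is a largest positive
integer `n` such that the equation `n x = b` is solvable in the group. -/
def HasTypeZero {G : Type*} [AddCommGroup G] (b : G) : Prop :=
  ∃ n : ℕ, IsGreatest {k : ℕ | 0 < k ∧ ∃ x : G, k • x = b} n

end FactorizationTheory

/-! Bounded factorization means a bound on the number of non-unit factors of each element; finite
factorization means finitely many divisors up to associates. Both properties pass down from `R[M]`
to `R` and to `M`, embedded as constants and as monomials: once the exponents are totally ordered,
leading coefficients and leading exponents are multiplicative, so the embeddings reflect units and
associates.

For the converse, let `G` be a torsion-free group containing `M`, with all nonzero elements of type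
zero, and let `K` be the fraction field of `R`. The core is `K[G]`. Two generic functionals project
supports to the rational plane, where a non-unit of `K[G]` has a Newton polygon with at least one
edge. Edges of a given slope add under multiplication, so every non-unit factor of `f` contributes
to an edge of `f`. The contributions to one edge are parallel vectors of `G` with the same
direction, hence multiples of one `e`, and the edge is `r • e` with `r` at least their number. Type
zero bounds `r`, and `f` has finitely many pairs of exponents; this is `exists_edges` and
`hasBoundedLength_of_hasTypeZero`.

So `K[G]` is atomic. Its irreducibles are prime, since a divisibility relation lives over some
`ℤ^n`, where the Laurent polynomial ring is factorial. Hence `K[G]` is factorial and has finite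
divisor sets.

Finally, an element of `R[M]` is controlled by its leading coefficient in `R`, its leading exponent
in `M` and its image in `K[G]`: if all three are units, so is the element, and if all three agree up
to units, so do two nonzero elements. Bounds and finiteness for the three combine into those for
`R[M]`. -/

namespace FactorizationTheory

/-! ### Bounded and finite factorization in terms of non-units and divisors -/

section Monoids

variable {H : Type*} [CommMonoid H]

/-- The number of factors in a factorization of `b` into non-units is bounded. -/
def HasBoundedLength (b : H) : Prop :=
  ∃ N : ℕ, ∀ s : Multiset H, (∀ a ∈ s, ¬ IsUnit a) → s.prod = b → s.card ≤ N

/-- Up to associates, `b` has only finitely many divisors. -/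
def HasFiniteDivisors (b : H) : Prop :=
  ∃ T : Set H, T.Finite ∧ ∀ d, d ∣ b → ∃ t ∈ T, Associated t d

theorem irreducible_associates_mk {a : H} : Irreducible (Associates.mk a) ↔ Irreducible a := by
  constructor
  · intro h
    refine ⟨fun hu ↦ h.not_isUnit (Associates.isUnit_mk.2 hu), fun x y hxy ↦ ?_⟩
    have := h.isUnit_or_isUnit (a := Associates.mk x) (b := Associates.mk y)
      (by rw [Associates.mk_mul_mk, hxy])
    simpa only [Associates.isUnit_mk] using this
  · intro h
    refine ⟨fun hu ↦ h.not_isUnit (Associates.isUnit_mk.1 hu), ?_⟩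
    intro x y hxy
    obtain ⟨x, rfl⟩ := Associates.mk_surjective x
    obtain ⟨y, rfl⟩ := Associates.mk_surjective y
    rw [Associates.mk_mul_mk, Associates.mk_eq_mk_iff_associated] at hxy
    obtain ⟨u, hu⟩ := hxy
    have := h.isUnit_or_isUnit (a := x) (b := y * ↑u⁻¹) (by rw [← mul_assoc, ← hu]; simp)
    simpa only [Associates.isUnit_mk, Units.isUnit_mul_units] using this

theorem IsAtomicMonoid.exists_mem_factorizationSet (h : IsAtomicMonoid H) (b : H) :
    ∃ z, z ∈ factorizationSet b := by
  by_cases hb : IsUnit b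
  · refine ⟨0, by simp, ?_⟩
    rw [Multiset.prod_zero, eq_comm, Associates.mk_eq_one]
    exact hb
  · obtain ⟨s, hs, rfl⟩ := h b hb
    refine ⟨s.map Associates.mk, ?_, Associates.prod_mk⟩
    simp only [Multiset.mem_map, forall_exists_index, and_imp]
    rintro _ a ha rfl
    exact irreducible_associates_mk.2 (hs a ha)

/-- Lifting to `H` gives `b` only up to a unit, which is absorbed into one factor; this is why `z`
must be nonempty. -/
theorem exists_nonunit_of_mem_factorizationSet {b : H} {z : Multiset (Associates H)}
    (hz : z ∈ factorizationSet b) (h0 : z ≠ 0) :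
    ∃ s : Multiset H, (∀ a ∈ s, ¬ IsUnit a) ∧ s.prod = b ∧ s.card = z.card := by
  obtain ⟨s, rfl⟩ := Multiset.map_surjective_of_surjective Associates.mk_surjective z
  obtain ⟨hirr, hprod⟩ := hz
  have hs : ∀ a ∈ s, ¬ IsUnit a := fun a ha hu ↦
    (hirr _ (Multiset.mem_map_of_mem _ ha)).not_isUnit (Associates.isUnit_mk.2 hu)
  rw [Associates.prod_mk, Associates.mk_eq_mk_iff_associated] at hprod
  obtain ⟨u, hu⟩ := hprod
  obtain ⟨a, ha⟩ := Multiset.exists_mem_of_ne_zero (s := s) (by simpa using h0)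
  obtain ⟨t, rfl⟩ := Multiset.exists_cons_of_mem ha
  refine ⟨(a * u) ::ₘ t, ?_, ?_, by simp⟩
  · intro x hx
    rcases Multiset.mem_cons.1 hx with rfl | hx
    · rw [Units.isUnit_mul_units]; exact hs a ha
    · exact hs x (Multiset.mem_cons_of_mem hx)
  · rw [← hu, Multiset.prod_cons, Multiset.prod_cons]; ac_rfl

/-- A factorization into non-units of maximal length cannot be refined, so its factors are
irreducible. -/
theorem isAtomicMonoid_of_hasBoundedLength (h : ∀ b : H, HasBoundedLength b) :
    IsAtomicMonoid H := by
  classical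
  intro b hb
  obtain ⟨N, hN⟩ := h b
  let P : ℕ → Prop := fun n ↦ ∃ s : Multiset H, (∀ a ∈ s, ¬ IsUnit a) ∧ s.prod = b ∧ s.card = n
  have hP1 : P 1 := ⟨{b}, by simpa using hb, by simp, by simp⟩
  have hPN : ∀ n, P n → n ≤ N := by
    rintro n ⟨s, hs, hp, rfl⟩
    exact hN s hs hp
  obtain ⟨s, hs, hp, hc⟩ := Nat.findGreatest_spec (hPN 1 hP1) hP1
  refine ⟨s, fun a ha ↦ ⟨hs a ha, fun x y hxy ↦ ?_⟩, hp⟩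
  by_contra! hu
  obtain ⟨t, rfl⟩ := Multiset.exists_cons_of_mem ha
  have hP : P (t.card + 2) := by
    refine ⟨x ::ₘ y ::ₘ t, ?_, ?_, by simp⟩
    · intro c hc
      simp only [Multiset.mem_cons] at hc
      rcases hc with rfl | rfl | hc
      exacts [hu.1, hu.2, hs c (Multiset.mem_cons_of_mem hc)]
    · rw [← hp]; simp [hxy, mul_assoc]
  have := Nat.le_findGreatest (hPN _ hP) hP
  rw [← hc, Multiset.card_cons] at this
  omega

theorem isBFM_iff : IsBFM H ↔ ∀ b : H, HasBoundedLength b := by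
  constructor
  · rintro ⟨hat, hfin⟩ b
    obtain ⟨N, hN⟩ := (hfin b).bddAbove
    refine ⟨N, fun s hs hp ↦ ?_⟩
    -- Splitting each non-unit into irreducibles can only increase the number of factors.
    choose! F hF using hat
    have hcard : s.card ≤ (s.bind F).card := by
      rw [Multiset.card_bind, ← Multiset.sum_map_toList]
      have : ∀ a ∈ s, 1 ≤ (Multiset.card ∘ F) a := by
        intro a ha
        rw [Function.comp_apply, Nat.one_le_iff_ne_zero, Ne, Multiset.card_eq_zero]
        intro h0
        apply hs a ha
        rw [← (hF a (hs a ha)).2, h0, Multiset.prod_zero]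
        exact isUnit_one
      rw [Multiset.sum_map_toList]
      simpa using Multiset.card_nsmul_le_sum (s := s.map (Multiset.card ∘ F)) (a := 1)
        (by simpa using this)
    refine hcard.trans (hN ⟨(s.bind F).map Associates.mk, ⟨?_, ?_⟩, by simp⟩)
    · intro x hx
      obtain ⟨a, ha, rfl⟩ := Multiset.mem_map.1 hx
      obtain ⟨c, hc, hac⟩ := Multiset.mem_bind.1 ha
      exact irreducible_associates_mk.2 ((hF c (hs c hc)).1 a hac)
    · rw [Associates.prod_mk, Multiset.prod_bind, ← hp]
      congr 2
      conv_rhs => rw [← Multiset.map_id s]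
      exact Multiset.map_congr rfl fun a ha ↦ (hF a (hs a ha)).2
  · intro h
    refine ⟨isAtomicMonoid_of_hasBoundedLength h, fun b ↦ ?_⟩
    obtain ⟨N, hN⟩ := h b
    refine (Set.finite_Iic N).subset ?_
    rintro _ ⟨z, hz, rfl⟩
    by_cases h0 : z = 0
    · simp [h0]
    · obtain ⟨s, hs, hp, hc⟩ := exists_nonunit_of_mem_factorizationSet hz h0
      exact hc ▸ hN s hs hp

theorem HasFiniteDivisors.finite_associates {b : H} (h : HasFiniteDivisors b) :
    {d : Associates H | d ∣ Associates.mk b}.Finite := by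
  obtain ⟨T, hT, hd⟩ := h
  refine (hT.image Associates.mk).subset ?_
  intro d hdb
  obtain ⟨d, rfl⟩ := Associates.mk_surjective d
  obtain ⟨t, ht, htd⟩ := hd d (Associates.mk_dvd_mk.1 hdb)
  exact ⟨t, ht, Associates.mk_eq_mk_iff_associated.2 htd⟩

theorem hasFiniteDivisors_of_finite_associates {b : H}
    (h : {d : Associates H | d ∣ Associates.mk b}.Finite) : HasFiniteDivisors b := by
  refine ⟨Quotient.out '' {d : Associates H | d ∣ Associates.mk b}, h.image _, fun d hd ↦ ?_⟩
  refine ⟨_, ⟨Associates.mk d, Associates.mk_dvd_mk.2 hd, rfl⟩, ?_⟩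
  rw [← Associates.mk_eq_mk_iff_associated]
  exact Quotient.out_eq _

/-- Removing a non-unit factor strictly shrinks the set of divisor classes, so their number bounds
the length. -/
theorem HasFiniteDivisors.hasBoundedLength [IsCancelMul H] {b : H} (h : HasFiniteDivisors b) :
    HasBoundedLength b := by
  refine ⟨{d : Associates H | d ∣ Associates.mk b}.ncard, fun s hs hp ↦ ?_⟩
  replace h := h.finite_associates
  induction s using Multiset.induction generalizing b with
  | empty => simp
  | cons a s ih =>
    rw [Multiset.prod_cons] at hp
    have hsub : {d : Associates H | d ∣ Associates.mk s.prod} ⊂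
        {d : Associates H | d ∣ Associates.mk b} := by
      refine ⟨fun d hd ↦ dvd_trans hd (Associates.mk_dvd_mk.2 ⟨a, by rw [← hp, mul_comm]⟩), ?_⟩
      intro hsub
      obtain ⟨q, hq⟩ := Associates.mk_dvd_mk.1 (hsub (dvd_refl (Associates.mk b)))
      apply hs a (Multiset.mem_cons_self a s)
      refine IsUnit.of_mul_eq_one q (mul_left_cancel (a := s.prod) ?_)
      rw [mul_one]
      nth_rw 2 [hq]
      rw [← hp]; ac_rfl
    have := ih (fun c hc ↦ hs c (Multiset.mem_cons_of_mem hc)) rfl (h.subset hsub.1)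
    have := Set.ncard_lt_ncard hsub h
    rw [Multiset.card_cons]
    omega

theorem isFFM_iff [IsCancelMul H] : IsFFM H ↔ ∀ b : H, HasFiniteDivisors b := by
  classical
  constructor
  · rintro ⟨hat, hfin⟩ b
    apply hasFiniteDivisors_of_finite_associates
    -- Every divisor class is the product of a sub-multiset of some factorization of `b`.
    refine ((hfin b).biUnion (t := fun z ↦ Multiset.prod '' {w | w ∈ z.powerset})
      fun z _ ↦ ((Multiset.finite_toSet z.powerset).image _)).subset ?_
    intro d hd
    obtain ⟨d, rfl⟩ := Associates.mk_surjective d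
    obtain ⟨e, rfl⟩ := Associates.mk_dvd_mk.1 hd
    obtain ⟨z, hz⟩ := hat.exists_mem_factorizationSet d
    obtain ⟨w, hw⟩ := hat.exists_mem_factorizationSet e
    refine Set.mem_biUnion (x := z + w) ⟨?_, ?_⟩ ⟨z, ?_, hz.2⟩
    · intro a ha
      rcases Multiset.mem_add.1 ha with ha | ha
      exacts [hz.1 a ha, hw.1 a ha]
    · rw [Multiset.prod_add, hz.2, hw.2, Associates.mk_mul_mk]
    · simp
  · intro h
    have hb : ∀ b : H, HasBoundedLength b := fun b ↦ (h b).hasBoundedLength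
    refine ⟨isAtomicMonoid_of_hasBoundedLength hb, fun b ↦ ?_⟩
    obtain ⟨N, hN⟩ := ((isBFM_iff.2 hb).2 b).bddAbove
    have hD := (h b).finite_associates
    -- With lengths at most `N`, every factorization lies inside `N` copies of the finite set of
    -- divisor classes.
    refine (Multiset.finite_toSet (N • hD.toFinset.val).powerset).subset ?_
    intro z hz
    change z ∈ (N • hD.toFinset.val).powerset
    rw [Multiset.mem_powerset, Multiset.le_iff_count]
    intro a
    by_cases ha : a ∈ z
    · have hmem : a ∈ hD.toFinset := by
        rw [Set.Finite.mem_toFinset, Set.mem_ofPred_eq, ← hz.2]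
        exact Multiset.dvd_prod ha
      rw [Multiset.count_nsmul, Multiset.count_eq_one_of_mem hD.toFinset.nodup hmem, mul_one]
      exact (Multiset.count_le_card a z).trans (hN ⟨z, hz, rfl⟩)
    · rw [Multiset.count_eq_zero_of_notMem ha]; exact Nat.zero_le _

end Monoids

/-! ### Passage from nonzero elements to the domain itself -/

section Domains

variable {R : Type*} [CommRing R]

theorem isUnit_nonZeroDivisors_iff {a : nonZeroDivisors R} : IsUnit a ↔ IsUnit (a : R) := by
  refine ⟨fun h ↦ h.map (nonZeroDivisors R).subtype, fun h ↦ ?_⟩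
  obtain ⟨c, hc⟩ := h.exists_right_inv
  have hu : IsUnit c := IsUnit.of_mul_eq_one (a : R) (by rw [mul_comm, hc])
  exact IsUnit.of_mul_eq_one ⟨c, hu.mem_nonZeroDivisors⟩ (Subtype.ext hc)

theorem isCancelMul_nonZeroDivisors : IsCancelMul (nonZeroDivisors R) where
  mul_left_cancel a b c h := Subtype.ext <| by
    have h' : (a : R) * b = a * c := congrArg Subtype.val h
    exact (mul_cancel_left_mem_nonZeroDivisors a.2).1 h'
  mul_right_cancel a b c h := Subtype.ext <| by
    have h' : (b : R) * a = c * a := congrArg Subtype.val h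
    exact (mul_cancel_right_mem_nonZeroDivisors a.2).1 h'

theorem isBFD_iff [IsDomain R] : IsBFD R ↔ ∀ b : R, b ≠ 0 → HasBoundedLength b := by
  rw [IsBFD, isBFM_iff]
  constructor
  · rintro ⟨-, h⟩ b hb
    obtain ⟨N, hN⟩ := h ⟨b, mem_nonZeroDivisors_of_ne_zero hb⟩
    refine ⟨N, fun s hs hp ↦ ?_⟩
    lift s to Multiset (nonZeroDivisors R) using fun a ha ↦
      mem_nonZeroDivisors_of_ne_zero fun h0 ↦ hb (by
        rw [← hp]; exact Multiset.prod_eq_zero (h0 ▸ ha))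
    rw [Multiset.card_map]
    refine hN s (fun a ha hu ↦ hs a (Multiset.mem_map_of_mem _ ha)
      (isUnit_nonZeroDivisors_iff.1 hu)) (Subtype.ext ?_)
    exact (map_multiset_prod (nonZeroDivisors R).subtype s).trans hp
  · intro h
    refine ⟨inferInstance, fun b ↦ ?_⟩
    obtain ⟨N, hN⟩ := h b (nonZeroDivisors.ne_zero b.2)
    refine ⟨N, fun s hs hp ↦ ?_⟩
    rw [← Multiset.card_map Subtype.val s]
    refine hN _ ?_ ?_
    · intro a ha
      obtain ⟨c, hc, rfl⟩ := Multiset.mem_map.1 ha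
      exact fun hu ↦ hs c hc (isUnit_nonZeroDivisors_iff.2 hu)
    · rw [← hp]
      exact (map_multiset_prod (nonZeroDivisors R).subtype s).symm

theorem isFFD_iff [IsDomain R] : IsFFD R ↔ ∀ b : R, b ≠ 0 → HasFiniteDivisors b := by
  have := isCancelMul_nonZeroDivisors (R := R)
  rw [IsFFD, isFFM_iff]
  constructor
  · rintro ⟨-, h⟩ b hb
    obtain ⟨T, hT, hd⟩ := h ⟨b, mem_nonZeroDivisors_of_ne_zero hb⟩
    refine ⟨Subtype.val '' T, hT.image _, ?_⟩
    rintro d ⟨e, rfl⟩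
    obtain ⟨t, ht, htd⟩ := hd ⟨d, mem_nonZeroDivisors_of_ne_zero (left_ne_zero_of_mul hb)⟩
      ⟨⟨e, mem_nonZeroDivisors_of_ne_zero (right_ne_zero_of_mul hb)⟩, rfl⟩
    exact ⟨t, ⟨t, ht, rfl⟩, htd.map (nonZeroDivisors R).subtype⟩
  · intro h
    refine ⟨inferInstance, fun b ↦ ?_⟩
    obtain ⟨T, hT, hd⟩ := h b (nonZeroDivisors.ne_zero b.2)
    refine ⟨Subtype.val ⁻¹' T, hT.preimage Subtype.val_injective.injOn, ?_⟩
    rintro d ⟨e, rfl⟩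
    obtain ⟨t, ht, u, hu⟩ := hd d ⟨e, rfl⟩
    have ht0 : t ≠ 0 := by
      rintro rfl
      rw [zero_mul] at hu
      exact nonZeroDivisors.ne_zero d.2 hu.symm
    refine ⟨⟨t, mem_nonZeroDivisors_of_ne_zero ht0⟩, ht, ?_⟩
    obtain ⟨v, hv⟩ := (isUnit_nonZeroDivisors_iff
      (a := ⟨(u : R), u.isUnit.mem_nonZeroDivisors⟩)).2 u.isUnit
    refine ⟨v, Subtype.ext ?_⟩
    rw [← hu, hv]; rfl

end Domains

/-! ### Pulling factorization properties back along homomorphisms -/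

section Transfer

variable {H H' : Type*} [CommMonoid H] [CommMonoid H']

theorem HasBoundedLength.of_map (φ : H →* H') (hφ : ∀ a, IsUnit (φ a) → IsUnit a) {b : H}
    (h : HasBoundedLength (φ b)) : HasBoundedLength b := by
  obtain ⟨N, hN⟩ := h
  refine ⟨N, fun s hs hp ↦ ?_⟩
  rw [← Multiset.card_map φ s]
  refine hN _ ?_ (by rw [← hp, map_multiset_prod])
  intro a ha
  obtain ⟨c, hc, rfl⟩ := Multiset.mem_map.1 ha
  exact fun hu ↦ hs c hc (hφ c hu)

theorem HasFiniteDivisors.of_map (φ : H →* H')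
    (hφ : ∀ a b, Associated (φ a) (φ b) → Associated a b) {b : H}
    (h : HasFiniteDivisors (φ b)) : HasFiniteDivisors b := by
  classical
  obtain ⟨T, hT, hd⟩ := h
  let F : H' → H := fun t ↦ if ht : ∃ a, Associated t (φ a) then ht.choose else 1
  refine ⟨F '' T, hT.image _, fun d hdb ↦ ?_⟩
  obtain ⟨t, ht, htd⟩ := hd (φ d) (map_dvd φ hdb)
  have hex : ∃ a, Associated t (φ a) := ⟨d, htd⟩
  refine ⟨F t, ⟨t, ht, rfl⟩, hφ _ _ ?_⟩
  have hF : F t = hex.choose := dif_pos hex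
  rw [hF]
  exact hex.choose_spec.symm.trans htd

end Transfer

/-! ### Leading terms, and descent from the monoid ring to coefficients and exponents -/

section Leading

variable {R M B : Type*} [CommRing R] [AddCommMonoid M]
  [AddCommMonoid B] [LinearOrder B]

/-- `p` is the unique point of the support of `f` at which `D` is maximal. -/
def IsStrictMax (D : M →+ B) (f : AddMonoidAlgebra R M) (p : M) : Prop :=
  f.coeff p ≠ 0 ∧ ∀ a, f.coeff a ≠ 0 → a ≠ p → D a < D p

theorem IsStrictMax.unique {D : M →+ B} {f : AddMonoidAlgebra R M} {p q : M}
    (hp : IsStrictMax D f p) (hq : IsStrictMax D f q) : p = q := by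
  by_contra h
  exact lt_asymm (hp.2 q hq.1 (Ne.symm h)) (hq.2 p hp.1 h)

theorem IsStrictMax.le {D : M →+ B} {f : AddMonoidAlgebra R M} {p a : M}
    (hp : IsStrictMax D f p) (ha : f.coeff a ≠ 0) : D a ≤ D p := by
  by_cases h : a = p
  · rw [h]
  · exact (hp.2 a ha h).le

theorem exists_isStrictMax {D : M →+ B} {f : AddMonoidAlgebra R M}
    (hD : ∀ a b, f.coeff a ≠ 0 → f.coeff b ≠ 0 → D a = D b → a = b) (hf : f ≠ 0) :
    ∃ p, IsStrictMax D f p := by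
  have hne : f.coeff.support.Nonempty := by
    rw [Finsupp.support_nonempty_iff, Ne, AddMonoidAlgebra.coeff_eq_zero]
    exact hf
  obtain ⟨p, hp, hmax⟩ := f.coeff.support.exists_max_image D hne
  rw [Finsupp.mem_support_iff] at hp
  refine ⟨p, hp, fun a ha hap ↦ lt_of_le_of_ne (hmax a (Finsupp.mem_support_iff.2 ha)) ?_⟩
  exact fun h ↦ hap (hD a p ha hp h)

theorem isStrictMax_single (D : M →+ B) (m : M) {c : R} (hc : c ≠ 0) :
    IsStrictMax D (AddMonoidAlgebra.single m c) m := by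
  classical
  refine ⟨by simpa using hc, fun a ha ham ↦ absurd ?_ ha⟩
  simp [Ne.symm ham]

theorem exists_add_of_coeff_mul_ne_zero {f g : AddMonoidAlgebra R M} {a : M}
    (h : (f * g).coeff a ≠ 0) : ∃ x y, f.coeff x ≠ 0 ∧ g.coeff y ≠ 0 ∧ x + y = a := by
  classical
  have := AddMonoidAlgebra.support_coeff_mul_subset f g (Finsupp.mem_support_iff.2 h)
  obtain ⟨x, hx, y, hy, hxy⟩ := Finset.mem_add.1 this
  exact ⟨x, y, Finsupp.mem_support_iff.1 hx, Finsupp.mem_support_iff.1 hy, hxy⟩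

variable [IsOrderedCancelAddMonoid B]

/-- Strict maximality makes `p + q` a sum of support points in only one way, so nothing else
contributes to this coefficient. -/
theorem IsStrictMax.coeff_mul {D : M →+ B} {f g : AddMonoidAlgebra R M} {p q : M}
    (hp : IsStrictMax D f p) (hq : IsStrictMax D g q) :
    (f * g).coeff (p + q) = f.coeff p * g.coeff q := by
  apply AddMonoidAlgebra.coeff_mul_add_of_uniqueAdd
  intro a b ha hb hab
  rw [Finsupp.mem_support_iff] at ha hb
  have hD : D a + D b = D p + D q := by rw [← map_add, hab, map_add]
  have ha' := hp.le ha
  have hb' := hq.le hb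
  constructor
  · by_contra h
    exact (add_lt_add_of_lt_of_le (hp.2 a ha h) hb').ne hD
  · by_contra h
    exact (add_lt_add_of_le_of_lt ha' (hq.2 b hb h)).ne hD

theorem IsStrictMax.mul [NoZeroDivisors R] {D : M →+ B} {f g : AddMonoidAlgebra R M} {p q : M}
    (hp : IsStrictMax D f p) (hq : IsStrictMax D g q) : IsStrictMax D (f * g) (p + q) := by
  refine ⟨?_, fun a ha hne ↦ ?_⟩
  · rw [hp.coeff_mul hq]
    exact mul_ne_zero hp.1 hq.1
  · obtain ⟨x, y, hx, hy, rfl⟩ := exists_add_of_coeff_mul_ne_zero ha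
    rw [map_add, map_add]
    by_cases hxp : x = p
    · have hyq : y ≠ q := fun h ↦ hne (by rw [hxp, h])
      exact add_lt_add_of_le_of_lt (hp.le hx) (hq.2 y hy hyq)
    · exact add_lt_add_of_lt_of_le (hp.2 x hx hxp) (hq.le hy)

theorem IsStrictMax.prod [IsDomain R] {D : M →+ B} {ι : Type*} (s : Finset ι)
    {f : ι → AddMonoidAlgebra R M} {p : ι → M} (h : ∀ i ∈ s, IsStrictMax D (f i) (p i)) :
    IsStrictMax D (∏ i ∈ s, f i) (∑ i ∈ s, p i) := by
  classical
  induction s using Finset.induction_on with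
  | empty =>
    rw [Finset.prod_empty, Finset.sum_empty, AddMonoidAlgebra.one_def]
    exact isStrictMax_single D 0 one_ne_zero
  | insert i s hi ih =>
    rw [Finset.prod_insert hi, Finset.sum_insert hi]
    exact (h i (Finset.mem_insert_self i s)).mul
      (ih fun j hj ↦ h j (Finset.mem_insert_of_mem hj))

open Classical in
/-- The exponent of the `D`-leading term. -/
noncomputable def leadExp (D : M →+ B) (f : AddMonoidAlgebra R M) : M :=
  if h : ∃ p, IsStrictMax D f p then h.choose else 0

/-- The coefficient of the `D`-leading term. -/
noncomputable def leadCoeff (D : M →+ B) (f : AddMonoidAlgebra R M) : R :=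
  f.coeff (leadExp D f)

omit [IsOrderedCancelAddMonoid B] in
theorem IsStrictMax.leadExp_eq {D : M →+ B} {f : AddMonoidAlgebra R M} {p : M}
    (hp : IsStrictMax D f p) : leadExp D f = p := by
  have h : ∃ p, IsStrictMax D f p := ⟨p, hp⟩
  rw [leadExp, dif_pos h]
  exact h.choose_spec.unique hp

omit [IsOrderedCancelAddMonoid B] in
theorem isStrictMax_leadExp {D : M →+ B} (hD : Function.Injective D) {f : AddMonoidAlgebra R M}
    (hf : f ≠ 0) : IsStrictMax D f (leadExp D f) := by
  obtain ⟨p, hp⟩ := exists_isStrictMax (fun a b _ _ h ↦ hD h) hf (D := D)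
  rwa [hp.leadExp_eq]

omit [IsOrderedCancelAddMonoid B] in
theorem leadCoeff_ne_zero {D : M →+ B} (hD : Function.Injective D) {f : AddMonoidAlgebra R M}
    (hf : f ≠ 0) : leadCoeff D f ≠ 0 :=
  (isStrictMax_leadExp hD hf).1

theorem leadExp_mul [NoZeroDivisors R] {D : M →+ B} (hD : Function.Injective D)
    {f g : AddMonoidAlgebra R M} (hf : f ≠ 0) (hg : g ≠ 0) :
    leadExp D (f * g) = leadExp D f + leadExp D g :=
  ((isStrictMax_leadExp hD hf).mul (isStrictMax_leadExp hD hg)).leadExp_eq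

theorem leadCoeff_mul [NoZeroDivisors R] {D : M →+ B} (hD : Function.Injective D)
    {f g : AddMonoidAlgebra R M} (hf : f ≠ 0) (hg : g ≠ 0) :
    leadCoeff D (f * g) = leadCoeff D f * leadCoeff D g := by
  rw [leadCoeff, leadExp_mul hD hf hg]
  exact (isStrictMax_leadExp hD hf).coeff_mul (isStrictMax_leadExp hD hg)

omit [IsOrderedCancelAddMonoid B] in
theorem leadExp_single (D : M →+ B) (m : M) {c : R} (hc : c ≠ 0) :
    leadExp D (AddMonoidAlgebra.single m c) = m :=
  (isStrictMax_single D m hc).leadExp_eq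

omit [IsOrderedCancelAddMonoid B] in
theorem leadCoeff_single (D : M →+ B) (m : M) {c : R} (hc : c ≠ 0) :
    leadCoeff D (AddMonoidAlgebra.single m c) = c := by
  rw [leadCoeff, leadExp_single D m hc]; simp

theorem isDomain_addMonoidAlgebra [IsDomain R] {D : M →+ B} (hD : Function.Injective D) :
    IsDomain (AddMonoidAlgebra R M) :=
  have : UniqueSums M := UniqueSums.of_injective_addHom D.toAddHom hD inferInstance
  inferInstance

variable [IsDomain R] {D : M →+ B} (hD : Function.Injective D)
include hD

theorem isUnit_leadCoeff {f : AddMonoidAlgebra R M} (hf : IsUnit f) : IsUnit (leadCoeff D f) := by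
  have := isDomain_addMonoidAlgebra (R := R) hD
  obtain ⟨g, hg⟩ := hf.exists_right_inv
  have hfg : f * g ≠ 0 := by rw [hg]; exact one_ne_zero
  have h := leadCoeff_mul hD (left_ne_zero_of_mul hfg) (right_ne_zero_of_mul hfg)
  rw [hg, AddMonoidAlgebra.one_def, leadCoeff_single D 0 one_ne_zero] at h
  exact IsUnit.of_mul_eq_one _ h.symm

theorem isUnit_ofAdd_leadExp {f : AddMonoidAlgebra R M} (hf : IsUnit f) :
    IsUnit (Multiplicative.ofAdd (leadExp D f)) := by
  have := isDomain_addMonoidAlgebra (R := R) hD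
  obtain ⟨g, hg⟩ := hf.exists_right_inv
  have hfg : f * g ≠ 0 := by rw [hg]; exact one_ne_zero
  have h := leadExp_mul hD (left_ne_zero_of_mul hfg) (right_ne_zero_of_mul hfg)
  rw [hg, AddMonoidAlgebra.one_def, leadExp_single D 0 one_ne_zero] at h
  exact IsUnit.of_mul_eq_one (Multiplicative.ofAdd (leadExp D g)) (congrArg Multiplicative.ofAdd h.symm)

theorem isUnit_of_isUnit_singleZero {r : R}
    (h : IsUnit (AddMonoidAlgebra.single (0 : M) r)) : IsUnit r := by
  have := isDomain_addMonoidAlgebra (R := R) hD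
  by_cases hr : r = 0
  · simp [hr] at h
  · rw [← leadCoeff_single D (0 : M) hr]
    exact isUnit_leadCoeff hD h

theorem isUnit_of_isUnit_single_one {m : M}
    (h : IsUnit (AddMonoidAlgebra.single m (1 : R))) : IsUnit (Multiplicative.ofAdd m) := by
  have h' := isUnit_ofAdd_leadExp hD h
  rwa [leadExp_single D m one_ne_zero] at h'

theorem associated_of_associated_singleZero {r s : R}
    (h : Associated (AddMonoidAlgebra.single (0 : M) r) (AddMonoidAlgebra.single (0 : M) s)) :
    Associated r s := by
  have := isDomain_addMonoidAlgebra (R := R) hD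
  obtain ⟨u, hu⟩ := h
  by_cases hr : r = 0
  · subst hr
    have hs : s = 0 := by simpa using hu.symm
    rw [hs]
  · have hs : s ≠ 0 := by
      rintro rfl
      simp [hr] at hu
    have hl := leadCoeff_mul hD (f := AddMonoidAlgebra.single (0 : M) r) (g := u)
      (by simpa using hr) u.ne_zero
    rw [hu, leadCoeff_single D _ hr, leadCoeff_single D _ hs] at hl
    obtain ⟨v, hv⟩ := isUnit_leadCoeff hD u.isUnit
    exact ⟨v, by rw [hv, hl]⟩

theorem associated_of_associated_single_one {m n : M}
    (h : Associated (AddMonoidAlgebra.single m (1 : R)) (AddMonoidAlgebra.single n (1 : R))) :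
    Associated (Multiplicative.ofAdd m) (Multiplicative.ofAdd n) := by
  have := isDomain_addMonoidAlgebra (R := R) hD
  obtain ⟨u, hu⟩ := h
  have hl := leadExp_mul hD (f := AddMonoidAlgebra.single m (1 : R)) (g := u)
    (by simp) u.ne_zero
  rw [hu, leadExp_single D _ one_ne_zero, leadExp_single D _ one_ne_zero] at hl
  obtain ⟨v, hv⟩ := isUnit_ofAdd_leadExp hD u.isUnit
  exact ⟨v, by rw [hv, hl]; rfl⟩

theorem isBFD_of_isBFD_addMonoidAlgebra (h : IsBFD (AddMonoidAlgebra R M)) : IsBFD R := by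
  have := isDomain_addMonoidAlgebra (R := R) hD
  rw [isBFD_iff] at h ⊢
  exact fun b hb ↦ (h _ (by simpa using hb)).of_map
    (AddMonoidAlgebra.singleZeroRingHom : R →+* AddMonoidAlgebra R M).toMonoidHom
    (fun a ↦ isUnit_of_isUnit_singleZero hD)

theorem isBFM_of_isBFD_addMonoidAlgebra (h : IsBFD (AddMonoidAlgebra R M)) :
    IsBFM (Multiplicative M) := by
  have := isDomain_addMonoidAlgebra (R := R) hD
  rw [isBFD_iff] at h
  rw [isBFM_iff]
  exact fun b ↦ (h _ (by simp)).of_map (AddMonoidAlgebra.of R M)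
    (fun a ↦ isUnit_of_isUnit_single_one hD)

theorem isFFD_of_isFFD_addMonoidAlgebra (h : IsFFD (AddMonoidAlgebra R M)) : IsFFD R := by
  have := isDomain_addMonoidAlgebra (R := R) hD
  rw [isFFD_iff] at h ⊢
  exact fun b hb ↦ (h _ (by simpa using hb)).of_map
    (AddMonoidAlgebra.singleZeroRingHom : R →+* AddMonoidAlgebra R M).toMonoidHom
    (fun a b ↦ associated_of_associated_singleZero hD)

theorem isFFM_of_isFFD_addMonoidAlgebra [IsCancelAdd M] (h : IsFFD (AddMonoidAlgebra R M)) :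
    IsFFM (Multiplicative M) := by
  have := isDomain_addMonoidAlgebra (R := R) hD
  rw [isFFD_iff] at h
  rw [isFFM_iff]
  exact fun b ↦ (h _ (by simp)).of_map (AddMonoidAlgebra.of R M)
    (fun a b ↦ associated_of_associated_single_one hD)

end Leading

/-! ### Generic planar projections and sums of parallel vectors -/

section Functionals

variable {G : Type*} [AddCommGroup G] [IsAddTorsionFree G]

/-- Two functionals on a torsion-free group, generic with respect to a finite set `U`: the first is
injective on `U`, and together they detect parallelism of differences of elements of `U`. -/
theorem exists_generic_functionals (U : Finset G) :
    ∃ l m : G →+ ℚ, (∀ x ∈ U, ∀ y ∈ U, l x = l y → x = y) ∧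
      ∀ x ∈ U, ∀ y ∈ U, ∀ z ∈ U, ∀ w ∈ U,
        m (x - y) * l (z - w) = m (z - w) * l (x - y) →
        ∀ a b : ℕ, (b : ℚ) * l (x - y) = a * l (z - w) → b • (x - y) = a • (z - w) := by
  classical
  let j : G →+ DivisibleHull G := DivisibleHull.coeAddMonoidHom G
  have hj : Function.Injective j := DivisibleHull.coe_injective
  -- Genericity means that `l` avoids the kernel condition on finitely many nonzero differences, and
  -- `m` on finitely many nonzero vectors measuring non-parallelism.
  let S : Finset (DivisibleHull G) := ((U ×ˢ U).image fun p ↦ j (p.1 - p.2)).filter (· ≠ 0)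
  obtain ⟨l, hl⟩ := Module.exists_dual_forall_apply_ne_zero (K := ℚ)
    (fun v : S ↦ (v : DivisibleHull G)) fun v ↦ (Finset.mem_filter.1 v.2).2
  let S' : Finset (DivisibleHull G) :=
    (((U ×ˢ U) ×ˢ (U ×ˢ U)).image fun p ↦
      l (j (p.1.1 - p.1.2)) • j (p.2.1 - p.2.2) - l (j (p.2.1 - p.2.2)) • j (p.1.1 - p.1.2)).filter
      (· ≠ 0)
  obtain ⟨m, hm⟩ := Module.exists_dual_forall_apply_ne_zero (K := ℚ)
    (fun v : S' ↦ (v : DivisibleHull G)) fun v ↦ (Finset.mem_filter.1 v.2).2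
  have hinj : ∀ x ∈ U, ∀ y ∈ U, l (j (x - y)) = 0 → x = y := by
    intro x hx y hy h
    by_contra hne
    refine hl ⟨j (x - y), Finset.mem_filter.2 ⟨Finset.mem_image.2
      ⟨(x, y), by simp [hx, hy], rfl⟩, ?_⟩⟩ h
    rw [Ne, map_eq_zero_iff j hj, sub_eq_zero]
    exact hne
  refine ⟨l.toAddMonoidHom.comp j, m.toAddMonoidHom.comp j, ?_, ?_⟩
  · intro x hx y hy h
    refine hinj x hx y hy ?_
    rw [map_sub, map_sub, sub_eq_zero]
    exact h
  · intro x hx y hy z hz w hw h a b hab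
    simp only [AddMonoidHom.comp_apply, LinearMap.toAddMonoidHom_coe] at h hab
    have hpar : l (j (x - y)) • j (z - w) - l (j (z - w)) • j (x - y) = 0 := by
      by_contra hne
      refine hm ⟨_, Finset.mem_filter.2 ⟨Finset.mem_image.2
        ⟨((x, y), (z, w)), by simp [hx, hy, hz, hw], rfl⟩, hne⟩⟩ ?_
      rw [map_sub, map_smul, map_smul, smul_eq_mul, smul_eq_mul]
      linarith
    by_cases h0 : l (j (z - w)) = 0
    · have hzw := hinj z hz w hw h0
      rw [h0, mul_zero, mul_eq_zero] at hab
      rcases hab with hb | hb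
      · rw [hzw, Nat.cast_eq_zero.1 hb]; simp
      · rw [hzw, hinj x hx y hy hb]; simp
    · apply hj
      rw [map_nsmul, map_nsmul]
      have h1 : l (j (z - w)) • (b • j (x - y)) = l (j (z - w)) • (a • j (z - w)) := by
        rw [sub_eq_zero] at hpar
        rw [← Nat.cast_smul_eq_nsmul ℚ b, ← Nat.cast_smul_eq_nsmul ℚ a, smul_comm, ← hpar,
          smul_smul, smul_smul, hab, mul_comm]
      exact smul_right_injective _ h0 h1

/-- A sum of parallel vectors, all in the same direction, is at least as divisible as the number of
nonzero summands. -/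
theorem exists_nsmul_eq_sum_of_parallel {ι : Type*} [Fintype ι] (δ : ι → G) (a : ι → ℕ)
    (h : ∀ i k, a i • δ k = a k • δ i) (h0 : ∀ i, a i = 0 → δ i = 0) (s : Finset ι)
    (hs : ∀ i ∈ s, δ i ≠ 0) : ∃ (r : ℕ) (e : G), r • e = ∑ i, δ i ∧ s.card ≤ r := by
  classical
  -- The Bézout coefficients of the `a i` produce the common primitive vector `e = ∑ u k • δ k`,
  -- with `δ i = (a i / g) • e`.
  obtain ⟨u, hu⟩ := Finset.gcd_eq_sum_mul Finset.univ fun i ↦ (a i : ℤ)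
  set g : ℤ := Finset.univ.gcd fun i ↦ (a i : ℤ) with hg
  have hdvd : ∀ i, g ∣ a i := fun i ↦ Finset.gcd_dvd (Finset.mem_univ i)
  have hg0 : 0 ≤ g := Int.nonneg_of_normalize_eq_self (Finset.normalize_gcd ..)
  choose c hc using hdvd
  rcases hg0.eq_or_lt with hg0 | hg0
  · have hδ : ∀ i, δ i = 0 := fun i ↦ h0 i (by have := hc i; rw [← hg0, zero_mul] at this; omega)
    refine ⟨0, 0, by simp [hδ], ?_⟩
    rw [Finset.card_eq_zero.2 (Finset.eq_empty_of_forall_notMem fun i hi ↦ hs i hi (hδ i))]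
  have hc0 : ∀ i, 0 ≤ c i := fun i ↦
    nonneg_of_mul_nonneg_right (by rw [← hc i]; exact Int.natCast_nonneg _) hg0
  set e : G := ∑ k, u k • δ k with he
  have hδ : ∀ i, δ i = c i • e := by
    intro i
    have h1 : g • δ i = g • (c i • e) := by
      rw [← mul_smul, ← hc i, he, Finset.smul_sum]
      nth_rw 1 [hu]
      rw [Finset.sum_smul]
      refine Finset.sum_congr rfl fun k _ ↦ ?_
      rw [mul_comm, mul_smul, natCast_zsmul, ← h i k, smul_comm, natCast_zsmul]
    exact zsmul_right_injective hg0.ne' h1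
  have hsum : 0 ≤ ∑ i, c i := Finset.sum_nonneg fun i _ ↦ hc0 i
  refine ⟨(∑ i, c i).toNat, e, ?_, ?_⟩
  · rw [← natCast_zsmul, Int.toNat_of_nonneg hsum, Finset.sum_smul]
    exact Finset.sum_congr rfl fun i _ ↦ (hδ i).symm
  · zify
    rw [Int.toNat_of_nonneg hsum]
    calc (s.card : ℤ) = ∑ i ∈ s, 1 := by simp
      _ ≤ ∑ i ∈ s, c i := Finset.sum_le_sum fun i hi ↦ by
          have : c i ≠ 0 := fun h ↦ hs i hi (by rw [hδ i, h, zero_smul])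
          have := hc0 i
          omega
      _ ≤ ∑ i, c i := Finset.sum_le_univ_sum_of_nonneg hc0

end Functionals

/-! ### Edges of Newton polygons of products -/

section Edges

variable {K G ι : Type*} [CommRing K] [IsDomain K] [AddCommGroup G] [IsAddTorsionFree G] [Fintype ι]

/-- Each factor with at least two terms contributes to an edge of the Newton polytope of the
product. An edge is recorded by its endpoints, and the number of factors contributing to it is
bounded by the divisibility of the difference of the endpoints. -/
theorem exists_edges (g : ι → AddMonoidAlgebra K G)
    (hg : ∀ i, ∃ x y, (g i).coeff x ≠ 0 ∧ (g i).coeff y ≠ 0 ∧ x ≠ y) :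
    ∃ σ : ι → G × G, ∀ i, (∏ j, g j).coeff (σ i).1 ≠ 0 ∧ (∏ j, g j).coeff (σ i).2 ≠ 0 ∧
      (σ i).1 ≠ (σ i).2 ∧ ∃ (r : ℕ) (e : G), r • e = (σ i).1 - (σ i).2 ∧
        ∀ s : Finset ι, (∀ j ∈ s, σ j = σ i) → s.card ≤ r := by
  classical
  let U : Finset G := Finset.univ.biUnion fun i ↦ (g i).coeff.support
  have hU : ∀ i x, (g i).coeff x ≠ 0 → x ∈ U := fun i x hx ↦
    Finset.mem_biUnion.2 ⟨i, Finset.mem_univ i, Finsupp.mem_support_iff.2 hx⟩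
  have hg0 : ∀ i, g i ≠ 0 := by
    intro i h
    obtain ⟨x, -, hx, -⟩ := hg i
    simp [h] at hx
  obtain ⟨l, m, hl, hlm⟩ := exists_generic_functionals U
  -- In the `(l, m)`-plane, `w c` is constant on lines of slope `c`. Breaking ties by `l` or `-l`
  -- selects the two ends `P c i` and `Q c i` of the face of the `i`-th factor where `w c` is
  -- maximal.
  let w : ℚ → G →+ ℚ := fun c ↦ m - (AddMonoidHom.mulLeft c).comp l
  have hw : ∀ c x, w c x = m x - c * l x := fun c x ↦ rfl
  let Dp : ℚ → G →+ ℚ ×ₗ ℚ := fun c ↦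
    { toFun := fun x ↦ toLex (w c x, l x), map_zero' := by simp, map_add' := by
        intro x y; rw [map_add, map_add]; rfl }
  let Dq : ℚ → G →+ ℚ ×ₗ ℚ := fun c ↦
    { toFun := fun x ↦ toLex (w c x, - l x), map_zero' := by simp, map_add' := by
        intro x y; rw [map_add, map_add, neg_add]; rfl }
  have hP : ∀ c i, ∃ p, IsStrictMax (Dp c) (g i) p := fun c i ↦ by
    refine exists_isStrictMax (fun a b ha hb h ↦ hl a (hU i a ha) b (hU i b hb) ?_) (hg0 i)
    exact congrArg (fun z ↦ (ofLex z).2) h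
  have hQ : ∀ c i, ∃ q, IsStrictMax (Dq c) (g i) q := fun c i ↦ by
    refine exists_isStrictMax (fun a b ha hb h ↦ hl a (hU i a ha) b (hU i b hb) ?_) (hg0 i)
    exact neg_injective (congrArg (fun z ↦ (ofLex z).2) h)
  choose P hP using hP
  choose Q hQ using hQ
  have hPle : ∀ c i x, (g i).coeff x ≠ 0 → w c x < w c (P c i) ∨
      w c x = w c (P c i) ∧ l x ≤ l (P c i) := fun c i x hx ↦
    Prod.Lex.toLex_le_toLex.1 ((hP c i).le hx)
  have hQle : ∀ c i x, (g i).coeff x ≠ 0 → w c x < w c (Q c i) ∨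
      w c x = w c (Q c i) ∧ - l x ≤ - l (Q c i) := fun c i x hx ↦
    Prod.Lex.toLex_le_toLex.1 ((hQ c i).le hx)
  have hPQ : ∀ c i, w c (P c i) = w c (Q c i) ∧ l (Q c i) ≤ l (P c i) := by
    intro c i
    rcases hPle c i _ (hQ c i).1 with h | h
    · rcases hQle c i _ (hP c i).1 with h' | h'
      · exact absurd h' h.not_gt
      · exact absurd h'.1 h.ne'
    · exact ⟨h.1.symm, h.2⟩
  have hPU : ∀ c i, P c i ∈ U := fun c i ↦ hU i _ (hP c i).1
  have hQU : ∀ c i, Q c i ∈ U := fun c i ↦ hU i _ (hQ c i).1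
  -- the slope of an edge of the `i`-th factor
  have hslope : ∀ i, ∃ c, P c i ≠ Q c i := by
    intro i
    obtain ⟨x, y, hx, hy, hxy⟩ := hg i
    obtain ⟨p, hp, hpmax⟩ := (g i).coeff.support.exists_max_image l
      ⟨x, Finsupp.mem_support_iff.2 hx⟩
    have hp' : (g i).coeff p ≠ 0 := Finsupp.mem_support_iff.1 hp
    have hlt : ∀ a, (g i).coeff a ≠ 0 → a ≠ p → 0 < l p - l a := by
      intro a ha hap
      refine sub_pos.2 (lt_of_le_of_ne (hpmax a (Finsupp.mem_support_iff.2 ha)) fun h ↦ ?_)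
      exact hap (hl a (hU i a ha) p (hU i p hp') h)
    have hne : ((g i).coeff.support.erase p).Nonempty := by
      by_cases hxp : x = p
      · exact ⟨y, Finset.mem_erase.2 ⟨fun h ↦ hxy (by rw [hxp, h]), Finsupp.mem_support_iff.2 hy⟩⟩
      · exact ⟨x, Finset.mem_erase.2 ⟨hxp, Finsupp.mem_support_iff.2 hx⟩⟩
    -- From the point `p` with the largest `l`, the smallest slope to another support point gives a
    -- line above the whole support: the upper edge ending at `p`.
    obtain ⟨a, ha, hamin⟩ := ((g i).coeff.support.erase p).exists_min_image
      (fun b ↦ (m p - m b) / (l p - l b)) hne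
    obtain ⟨hap, ha⟩ := Finset.mem_erase.1 ha
    have ha' : (g i).coeff a ≠ 0 := Finsupp.mem_support_iff.1 ha
    refine ⟨(m p - m a) / (l p - l a), fun hPQi ↦ ?_⟩
    set c := (m p - m a) / (l p - l a) with hc
    have hwa : w c a = w c p := by
      have : c * (l p - l a) = m p - m a := div_mul_cancel₀ _ (hlt a ha' hap).ne'
      rw [hw, hw]; linarith
    have hwle : ∀ b, (g i).coeff b ≠ 0 → w c b ≤ w c p := by
      intro b hb
      by_cases hbp : b = p
      · rw [hbp]
      · have h1 := hamin b (Finset.mem_erase.2 ⟨hbp, Finsupp.mem_support_iff.2 hb⟩)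
        rw [le_div_iff₀ (hlt b hb hbp)] at h1
        rw [hw, hw]; linarith
    -- If the two ends of the face coincided, `l` would be constant on it, yet `a` and `p` both lie
    -- there.
    have key : ∀ b, (g i).coeff b ≠ 0 → w c b = w c p → l b = l (P c i) := by
      intro b hb hbp
      have h1 := hwle _ (hP c i).1
      have h2 : l b ≤ l (P c i) := by
        rcases hPle c i b hb with h | h
        · linarith
        · exact h.2
      have h3 : l (Q c i) ≤ l b := by
        rcases hQle c i b hb with h | h
        · rw [← hPQi] at h; linarith
        · linarith [h.2]
      rw [← hPQi] at h3
      exact le_antisymm h2 h3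
    exact hap (hl a (hU i a ha') p (hU i p hp') ((key a ha' hwa).trans (key p hp' rfl).symm))
  choose c hc using hslope
  have hSmax : ∀ c, IsStrictMax (Dp c) (∏ j, g j) (∑ j, P c j) := fun c ↦
    IsStrictMax.prod _ fun j _ ↦ hP c j
  have hTmax : ∀ c, IsStrictMax (Dq c) (∏ j, g j) (∑ j, Q c j) := fun c ↦
    IsStrictMax.prod _ fun j _ ↦ hQ c j
  have hlST : ∀ i, l (∑ j, Q (c i) j) < l (∑ j, P (c i) j) := by
    intro i
    rw [map_sum, map_sum]
    refine Finset.sum_lt_sum (fun j _ ↦ (hPQ (c i) j).2) ⟨i, Finset.mem_univ i, ?_⟩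
    refine lt_of_le_of_ne (hPQ (c i) i).2 fun h ↦ hc i ?_
    exact (hl _ (hQU _ _) _ (hPU _ _) h).symm
  have hwST : ∀ d, w d (∑ j, P d j) = w d (∑ j, Q d j) := fun d ↦ by
    rw [map_sum, map_sum]
    exact Finset.sum_congr rfl fun j _ ↦ (hPQ d j).1
  refine ⟨fun i ↦ (∑ j, P (c i) j, ∑ j, Q (c i) j), fun i ↦ ⟨(hSmax _).1, (hTmax _).1,
    fun h ↦ (hlST i).ne (congrArg l h.symm), ?_⟩⟩
  -- The endpoints of an edge determine its slope, because `l` separates them.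
  have hcc : ∀ j, ((∑ k, P (c j) k, ∑ k, Q (c j) k) : G × G) = (∑ k, P (c i) k, ∑ k, Q (c i) k) →
      c j = c i := by
    intro j hj
    obtain ⟨h1, h2⟩ := Prod.mk.inj hj
    have e1 := hwST (c i)
    have e2 := hwST (c j)
    rw [h1, h2] at e2
    rw [hw, hw] at e1 e2
    have h3 := hlST i
    have h4 : (c j - c i) * (l (∑ k, P (c i) k) - l (∑ k, Q (c i) k)) = 0 := by linarith
    rcases mul_eq_zero.1 h4 with h | h <;> linarith
  -- clear denominators to compare the parallel vectors `P - Q`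
  set d := c i with hd
  have hl0 : ∀ j, 0 ≤ l (P d j - Q d j) := fun j ↦ by
    rw [map_sub]; exact sub_nonneg.2 (hPQ d j).2
  let N : ℕ := ∏ j, (l (P d j - Q d j)).den
  have hN0 : N ≠ 0 := Finset.prod_ne_zero_iff.2 fun j _ ↦ Rat.den_ne_zero _
  have hN : ∀ j, ∃ a : ℕ, (a : ℚ) = N * l (P d j - Q d j) := by
    intro j
    obtain ⟨t, ht⟩ : (l (P d j - Q d j)).den ∣ N := Finset.dvd_prod_of_mem _ (Finset.mem_univ j)
    refine ⟨t * (l (P d j - Q d j)).num.toNat, ?_⟩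
    have hnum : (((l (P d j - Q d j)).num.toNat : ℕ) : ℚ) = ((l (P d j - Q d j)).num : ℚ) := by
      exact_mod_cast congrArg (Int.cast (R := ℚ))
        (Int.toNat_of_nonneg (Rat.num_nonneg.2 (hl0 j)))
    rw [ht, Nat.cast_mul, Nat.cast_mul, hnum, ← Rat.mul_den_eq_num]
    ring
  choose a ha using hN
  have hm : ∀ j, m (P d j - Q d j) = d * l (P d j - Q d j) := by
    intro j
    have := (hPQ d j).1
    rw [hw, hw] at this
    rw [map_sub, map_sub]; linarith
  obtain ⟨r, e, hre, hr⟩ : ∃ (r : ℕ) (e : G), r • e = ∑ j, (P d j - Q d j) ∧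
      (Finset.univ.filter fun j ↦ P d j - Q d j ≠ 0).card ≤ r := by
    refine exists_nsmul_eq_sum_of_parallel (fun j ↦ P d j - Q d j) a ?_ ?_ _ (by simp)
    · intro j k
      refine hlm _ (hPU d k) _ (hQU d k) _ (hPU d j) _ (hQU d j) ?_ _ _ ?_
      · rw [hm, hm]; ring
      · rw [ha, ha]; ring
    · intro j hj
      have h1 := ha j
      rw [hj, Nat.cast_zero, eq_comm, mul_eq_zero, or_iff_right (Nat.cast_ne_zero.2 hN0), map_sub,
        sub_eq_zero] at h1
      rw [sub_eq_zero]
      exact hl _ (hPU d j) _ (hQU d j) h1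
  refine ⟨r, e, by rw [hre, Finset.sum_sub_distrib], fun s hs ↦ le_trans ?_ hr⟩
  -- Factors recorded at the same edge share the slope `d`, so each has `P d j ≠ Q d j` and is
  -- counted.
  refine Finset.card_le_card fun j hj ↦ Finset.mem_filter.2 ⟨Finset.mem_univ j, ?_⟩
  rw [sub_ne_zero, ← hcc j (hs j hj)]
  exact hc j

end Edges

/-! ### Bounded factorization in group algebras over a field -/

section Fields

variable {K G : Type*} [Field K] [AddCommGroup G]

theorem isUnit_single (x : G) {c : K} (hc : c ≠ 0) : IsUnit (AddMonoidAlgebra.single x c) := by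
  refine IsUnit.of_mul_eq_one (AddMonoidAlgebra.single (-x) c⁻¹) ?_
  rw [AddMonoidAlgebra.single_mul_single, add_neg_cancel, mul_inv_cancel₀ hc,
    AddMonoidAlgebra.one_def]

theorem exists_ne_coeff_ne_zero_of_not_isUnit {f : AddMonoidAlgebra K G} (h0 : f ≠ 0)
    (hf : ¬ IsUnit f) : ∃ x y, f.coeff x ≠ 0 ∧ f.coeff y ≠ 0 ∧ x ≠ y := by
  classical
  by_contra! h
  have hne : f.coeff.support.Nonempty := by
    rw [Finsupp.support_nonempty_iff, Ne, AddMonoidAlgebra.coeff_eq_zero]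
    exact h0
  obtain ⟨x, hx⟩ := hne
  rw [Finsupp.mem_support_iff] at hx
  have : f = AddMonoidAlgebra.single x (f.coeff x) := by
    ext y
    rw [AddMonoidAlgebra.coeff_single, Finsupp.single_apply]
    split_ifs with hxy
    · rw [hxy]
    · by_contra hy
      exact hxy (h x y hx hy)
  rw [this] at hf
  exact hf (isUnit_single x hx)

/-- Over a field, every nonzero element of the group algebra of a torsion-free group all of whose
nonzero elements have type `(0, 0, …)` has factorizations of bounded length only. -/
theorem hasBoundedLength_of_hasTypeZero [IsAddTorsionFree G]
    (hG : ∀ b : G, b ≠ 0 → HasTypeZero b) {f : AddMonoidAlgebra K G} (hf : f ≠ 0) :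
    HasBoundedLength f := by
  classical
  choose! n hn using hG
  let S := f.coeff.support ×ˢ f.coeff.support
  refine ⟨∑ p ∈ S, n (p.1 - p.2), fun t ht hp ↦ ?_⟩
  obtain ⟨L, rfl⟩ := Quot.exists_rep t
  have hprod : ∏ i : Fin L.length, L.get i = f := by
    rw [← hp, ← List.prod_ofFn, List.ofFn_get]
    exact (Multiset.prod_coe L).symm
  have hne : ∀ i, L.get i ≠ 0 := fun i h ↦ hf (by
    rw [← hprod]; exact Finset.prod_eq_zero (Finset.mem_univ i) h)
  obtain ⟨σ, hσ⟩ := exists_edges (fun i : Fin L.length ↦ L.get i) fun i ↦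
    exists_ne_coeff_ne_zero_of_not_isUnit (hne i) (ht _ (Multiset.mem_coe.2 (List.get_mem L i)))
  rw [hprod] at hσ
  have hmaps : ∀ i ∈ (Finset.univ : Finset (Fin L.length)), σ i ∈ S := fun i _ ↦
    Finset.mem_product.2 ⟨Finsupp.mem_support_iff.2 (hσ i).1,
      Finsupp.mem_support_iff.2 (hσ i).2.1⟩
  calc Multiset.card (L : Multiset (AddMonoidAlgebra K G))
      = (Finset.univ : Finset (Fin L.length)).card := by simp
    _ = ∑ p ∈ S, (Finset.univ.filter fun i ↦ σ i = p).card :=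
      Finset.card_eq_sum_card_fiberwise hmaps
    _ ≤ ∑ p ∈ S, n (p.1 - p.2) := by
      refine Finset.sum_le_sum fun p _ ↦ ?_
      rcases (Finset.univ.filter fun i ↦ σ i = p).eq_empty_or_nonempty with h | ⟨i, hi⟩
      · rw [h]; simp
      · have hi' : σ i = p := (Finset.mem_filter.1 hi).2
        subst hi'
        obtain ⟨-, -, hST, r, e, hre, hr⟩ := hσ i
        have hb : (σ i).1 - (σ i).2 ≠ 0 := sub_ne_zero.2 hST
        refine (hr _ fun j hj ↦ (Finset.mem_filter.1 hj).2).trans ((hn _ hb).2 ⟨?_, e, hre⟩)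
        rw [Nat.pos_iff_ne_zero]
        rintro rfl
        exact hb (by rw [← hre, zero_smul])

end Fields

/-! ### Unique factorization for Laurent polynomials -/

section Localization

variable {K P Q : Type*} [Field K] [AddCommMonoid P] [AddCommGroup Q]

/-- If every element of the group `Q` is a difference of elements of the submonoid `P`, then `K[Q]`
is a localization of `K[P]`, and so inherits unique factorization. -/
theorem uniqueFactorizationMonoid_of_differences (f : P →+ Q) (hf : Function.Injective f)
    (hfQ : ∀ q : Q, ∃ p p' : P, q + f p = f p')
    [UniqueFactorizationMonoid (AddMonoidAlgebra K P)] :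
    UniqueFactorizationMonoid (AddMonoidAlgebra K Q) := by
  let φ : AddMonoidAlgebra K P →+* AddMonoidAlgebra K Q := AddMonoidAlgebra.mapDomainRingHom K f
  have hφ : Function.Injective φ := AddMonoidAlgebra.mapDomain_injective hf
  have hφs : ∀ (p : P) (c : K), φ (AddMonoidAlgebra.single p c) = AddMonoidAlgebra.single (f p) c :=
    fun p c ↦ AddMonoidAlgebra.mapDomain_single
  let _ : Algebra (AddMonoidAlgebra K P) (AddMonoidAlgebra K Q) := φ.toAlgebra
  let S : Submonoid (AddMonoidAlgebra K P) := MonoidHom.mrange (AddMonoidAlgebra.of K P)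
  have hunit : ∀ y : S, IsUnit (φ y) := by
    rintro ⟨_, p, rfl⟩
    change IsUnit (φ (AddMonoidAlgebra.single p.toAdd 1))
    rw [hφs]
    exact isUnit_single _ one_ne_zero
  have hsurj : ∀ z : AddMonoidAlgebra K Q, ∃ x : AddMonoidAlgebra K P × S, z * φ x.2 = φ x.1 := by
    intro z
    induction z using AddMonoidAlgebra.induction_linear with
    | zero => exact ⟨(0, 1), by simp⟩
    | add x y hx hy =>
      obtain ⟨⟨a, s⟩, ha⟩ := hx
      obtain ⟨⟨b, t⟩, hb⟩ := hy
      refine ⟨(a * t + b * s, s * t), ?_⟩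
      simp only [Submonoid.coe_mul, map_mul, map_add] at ha hb ⊢
      rw [← ha, ← hb]; ring
    | single q c =>
      obtain ⟨p, p', h⟩ := hfQ q
      refine ⟨(AddMonoidAlgebra.single p' c, ⟨_, Multiplicative.ofAdd p, rfl⟩), ?_⟩
      simp only [AddMonoidAlgebra.of_apply, hφs, AddMonoidAlgebra.single_mul_single, mul_one,
        toAdd_ofAdd, h]
  have : IsLocalization S (AddMonoidAlgebra K Q) :=
    { map_units := hunit
      surj := hsurj
      exists_of_eq := fun {x y} h ↦ ⟨1, by rw [hφ h]⟩ }
  exact UniqueFactorizationMonoid.of_isLocalization S (AddMonoidAlgebra K Q)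

instance uniqueFactorizationMonoid_laurent (n : ℕ) :
    UniqueFactorizationMonoid (AddMonoidAlgebra K (Fin n →₀ ℤ)) := by
  have : UniqueFactorizationMonoid (AddMonoidAlgebra K (Fin n →₀ ℕ)) :=
    inferInstanceAs (UniqueFactorizationMonoid (MvPolynomial (Fin n) K))
  refine uniqueFactorizationMonoid_of_differences
    (Finsupp.mapRange.addMonoidHom (Nat.castAddMonoidHom ℤ))
    (Finsupp.mapRange_injective _ (map_zero _) Nat.cast_injective) fun q ↦ ?_
  -- An integer vector plus its negative part is its positive part.
  refine ⟨q.mapRange (fun z ↦ (-z).toNat) (by simp), q.mapRange (fun z ↦ z.toNat) (by simp), ?_⟩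
  ext i
  simp
  omega

end Localization

/-! ### Group algebras over a field: irreducibles are prime, divisor sets are finite -/

section Descent

theorem irreducible_coe_nonZeroDivisors {R : Type*} [CommRing R] [IsDomain R]
    {a : nonZeroDivisors R} (ha : Irreducible a) : Irreducible (a : R) := by
  refine ⟨fun h ↦ ha.not_isUnit (isUnit_nonZeroDivisors_iff.2 h), fun x y hxy ↦ ?_⟩
  have hne : x * y ≠ 0 := hxy ▸ nonZeroDivisors.ne_zero a.2
  have := ha.isUnit_or_isUnit (a := ⟨x, mem_nonZeroDivisors_of_ne_zero (left_ne_zero_of_mul hne)⟩)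
    (b := ⟨y, mem_nonZeroDivisors_of_ne_zero (right_ne_zero_of_mul hne)⟩) (Subtype.ext hxy)
  simpa only [isUnit_nonZeroDivisors_iff] using this

variable {K G H : Type*} [Field K] [AddCommGroup G] [AddCommGroup H]

theorem exists_injective_hom_of_finset [IsAddTorsionFree G] (A : Finset G) :
    ∃ (n : ℕ) (φ : (Fin n →₀ ℤ) →+ G), Function.Injective φ ∧ (A : Set G) ⊆ Set.range φ := by
  let N : Submodule ℤ G := Submodule.span ℤ A
  have : Module.Finite ℤ N := Module.Finite.span_finset ℤ A
  have : Module.Free ℤ N := inferInstance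
  let b := Module.finBasis ℤ N
  refine ⟨_, (N.subtype.comp b.repr.symm.toLinearMap).toAddMonoidHom, ?_, fun a ha ↦ ?_⟩
  · exact N.subtype_injective.comp b.repr.symm.injective
  · exact ⟨b.repr ⟨a, Submodule.subset_span ha⟩, by simp⟩

/-- Restriction of supports to `H` is a `K[H]`-linear retraction of `K[G]`; it carries inverses
back, so the inclusion reflects units. -/
theorem comapDomain_map_mul (φ : H →+ G) (hφ : Function.Injective φ) (u : AddMonoidAlgebra K H)
    (v : AddMonoidAlgebra K G) :
    AddMonoidAlgebra.comapDomain φ hφ (AddMonoidAlgebra.mapDomain φ u * v) =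
      u * AddMonoidAlgebra.comapDomain φ hφ v := by
  induction u using AddMonoidAlgebra.induction_linear with
  | zero => simp
  | add x y hx hy =>
    rw [AddMonoidAlgebra.mapDomain_add, add_mul, AddMonoidAlgebra.comapDomain_add, hx, hy, add_mul]
  | single h c =>
    ext x
    rw [AddMonoidAlgebra.mapDomain_single]
    obtain ⟨y, rfl⟩ : ∃ y, x = h + y := ⟨x - h, by abel⟩
    simp

theorem isUnit_of_isUnit_mapDomain (φ : H →+ G) (hφ : Function.Injective φ)
    {u : AddMonoidAlgebra K H} (hu : IsUnit (AddMonoidAlgebra.mapDomain φ u)) : IsUnit u := by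
  obtain ⟨v, hv⟩ := hu.exists_right_inv
  refine IsUnit.of_mul_eq_one (AddMonoidAlgebra.comapDomain φ hφ v) ?_
  rw [← comapDomain_map_mul, hv, AddMonoidAlgebra.one_def, AddMonoidAlgebra.one_def, ← map_zero φ,
    AddMonoidAlgebra.comapDomain_single_map]

/-- The supports in `p * c = a * b` lie in a finitely generated, hence free, subgroup. There `p`
stays irreducible, as units are reflected, and the Laurent ring is factorial. -/
theorem prime_of_irreducible_addMonoidAlgebra [IsAddTorsionFree G] {p : AddMonoidAlgebra K G}
    (hp : Irreducible p) : Prime p := by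
  classical
  refine ⟨hp.ne_zero, hp.not_isUnit, ?_⟩
  rintro a b ⟨c, hc⟩
  obtain ⟨n, φ, hφ, hA⟩ := exists_injective_hom_of_finset
    (a.coeff.support ∪ b.coeff.support ∪ (c.coeff.support ∪ p.coeff.support))
  let Φ : AddMonoidAlgebra K (Fin n →₀ ℤ) →+* AddMonoidAlgebra K G :=
    AddMonoidAlgebra.mapDomainRingHom K φ
  have hΦ : Function.Injective Φ := AddMonoidAlgebra.mapDomain_injective hφ
  have hΦu : ∀ x, IsUnit (Φ x) → IsUnit x := fun x ↦ isUnit_of_isUnit_mapDomain φ hφ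
  have lift : ∀ x : AddMonoidAlgebra K G, (x.coeff.support : Set G) ⊆ Set.range φ →
      ∃ y, Φ y = x := fun x hx ↦ ⟨_, AddMonoidAlgebra.mapDomain_comapDomain hx hφ⟩
  simp only [Finset.coe_union, Set.union_subset_iff] at hA
  obtain ⟨a, rfl⟩ := lift a hA.1.1
  obtain ⟨b, rfl⟩ := lift b hA.1.2
  obtain ⟨c, rfl⟩ := lift c hA.2.1
  obtain ⟨p, rfl⟩ := lift p hA.2.2
  rw [← map_mul, ← map_mul] at hc
  have hirr : Irreducible p := by
    refine ⟨fun h ↦ hp.not_isUnit (h.map Φ), fun x y hxy ↦ ?_⟩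
    have := hp.isUnit_or_isUnit (a := Φ x) (b := Φ y) (by rw [hxy, map_mul])
    exact this.imp (hΦu x) (hΦu y)
  have hprime : Prime p := UniqueFactorizationMonoid.irreducible_iff_prime.1 hirr
  exact (hprime.dvd_or_dvd ⟨c, hΦ hc⟩).imp (map_dvd Φ) (map_dvd Φ)

theorem hasFiniteDivisors_of_hasTypeZero [IsAddTorsionFree G]
    (hG : ∀ b : G, b ≠ 0 → HasTypeZero b) {f : AddMonoidAlgebra K G} (hf : f ≠ 0) :
    HasFiniteDivisors f := by
  have : UniqueSums G := UniqueSums.of_injective_addHom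
    (DivisibleHull.coeAddMonoidHom G).toAddHom DivisibleHull.coe_injective inferInstance
  have hdom : IsDomain (AddMonoidAlgebra K G) := inferInstance
  have hat : IsBFD (AddMonoidAlgebra K G) :=
    isBFD_iff.2 fun b hb ↦ hasBoundedLength_of_hasTypeZero hG hb
  have hufd : UniqueFactorizationMonoid (AddMonoidAlgebra K G) := by
    refine UniqueFactorizationMonoid.of_exists_prime_factors fun a ha ↦ ?_
    by_cases hu : IsUnit a
    · exact ⟨0, by simp, by simpa using (associated_one_iff_isUnit.2 hu).symm⟩
    · obtain ⟨s, hs, hsa⟩ := hat.2.1 ⟨a, mem_nonZeroDivisors_of_ne_zero ha⟩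
        (fun h ↦ hu (isUnit_nonZeroDivisors_iff.1 h))
      refine ⟨s.map Subtype.val, ?_, Associated.of_eq ?_⟩
      · intro b hb
        obtain ⟨c, hc, rfl⟩ := Multiset.mem_map.1 hb
        exact prime_of_irreducible_addMonoidAlgebra (irreducible_coe_nonZeroDivisors (hs c hc))
      · exact (map_multiset_prod (nonZeroDivisors _).subtype s).symm.trans
          (congrArg Subtype.val hsa)
  apply hasFiniteDivisors_of_finite_associates
  have := UniqueFactorizationMonoid.fintypeSubtypeDvd (Associates.mk f) (Associates.mk_ne_zero.2 hf)
  exact Set.finite_coe_iff.1 (Finite.of_fintype {d // d ∣ Associates.mk f})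

end Descent

universe u

/-- The divisible hull is a rational vector space; coordinates in a well-ordered basis are compared
lexicographically. -/
theorem exists_injective_hom_ordered (G : Type u) [AddCommGroup G] [IsAddTorsionFree G] :
    ∃ (B : Type u) (_ : AddCommGroup B) (_ : LinearOrder B) (_ : IsOrderedAddMonoid B)
      (D : G →+ B), Function.Injective D := by
  classical
  let b := Module.Basis.ofVectorSpace ℚ (DivisibleHull G)
  let _ : LinearOrder (Module.Basis.ofVectorSpaceIndex ℚ (DivisibleHull G)) :=
    linearOrderOfSTO WellOrderingRel
  refine ⟨Lex (Module.Basis.ofVectorSpaceIndex ℚ (DivisibleHull G) →₀ ℚ), inferInstance,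
    inferInstance, inferInstance,
    { toFun := fun g ↦ toLex (b.repr (DivisibleHull.coeAddMonoidHom G g))
      map_zero' := by rw [map_zero, map_zero]; rfl
      map_add' := fun x y ↦ by rw [map_add, map_add]; rfl }, ?_⟩
  exact fun x y h ↦ DivisibleHull.coe_injective (b.repr.injective (toLex.injective h))

/-! ### Counting non-unit factors -/

section Counting

/-- Images of non-units may be units, so units must be allowed in the product; they are absorbed
into one non-unit. -/
theorem HasBoundedLength.exists_countP_le {H : Type*} [CommMonoid H] {b : H}
    [DecidablePred fun a : H ↦ ¬ IsUnit a] (h : HasBoundedLength b) :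
    ∃ N : ℕ, ∀ s : Multiset H, s.prod = b → s.countP (fun a ↦ ¬ IsUnit a) ≤ N := by
  obtain ⟨N, hN⟩ := h
  refine ⟨N, fun s hs ↦ ?_⟩
  rw [Multiset.countP_eq_card_filter]
  rcases Multiset.empty_or_exists_mem (s.filter fun a ↦ ¬ IsUnit a) with h0 | ⟨a, ha⟩
  · rw [h0]; simp
  have hunit : IsUnit (s.filter fun a ↦ ¬ ¬ IsUnit a).prod := by
    refine IsUnit.multisetProd_iff.2 fun x hx ↦ ?_
    exact not_not.1 (Multiset.mem_filter.1 hx).2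
  obtain ⟨w, hw⟩ := hunit
  have hprod := Multiset.prod_filter_mul_prod_filter_not (s := s) (fun a : H ↦ ¬ IsUnit a)
  have hnon : ∀ x ∈ s.filter fun a ↦ ¬ IsUnit a, ¬ IsUnit x := fun x hx ↦
    (Multiset.mem_filter.1 hx).2
  obtain ⟨t, ht⟩ := Multiset.exists_cons_of_mem ha
  rw [ht] at hprod hnon ⊢
  have := hN ((a * w) ::ₘ t) ?_ ?_
  · simpa using this
  · intro x hx
    rcases Multiset.mem_cons.1 hx with rfl | hx
    · rw [Units.isUnit_mul_units]
      exact hnon a (Multiset.mem_cons_self a t)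
    · exact hnon x (Multiset.mem_cons_of_mem hx)
  · rw [← hs, ← hprod, ← hw, Multiset.prod_cons, Multiset.prod_cons]; ac_rfl

theorem card_le_countP_add {α : Type*} (p q r : α → Prop) [DecidablePred p]
    [DecidablePred q] [DecidablePred r] (s : Multiset α) (h : ∀ a ∈ s, p a ∨ q a ∨ r a) :
    s.card ≤ s.countP p + s.countP q + s.countP r := by
  induction s using Multiset.induction with
  | empty => simp
  | cons a s ih =>
    have h1 := ih fun b hb ↦ h b (Multiset.mem_cons_of_mem hb)
    have h2 := h a (Multiset.mem_cons_self a s)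
    rw [Multiset.card_cons, Multiset.countP_cons, Multiset.countP_cons, Multiset.countP_cons]
    split_ifs <;> first | omega | tauto

theorem map_multiset_prod_of_ne_zero {A H : Type*} [CommRing A] [IsDomain A] [CommMonoid H]
    (F : A → H) (h1 : F 1 = 1) (hmul : ∀ f g, f ≠ 0 → g ≠ 0 → F (f * g) = F f * F g)
    (s : Multiset A) (hs : s.prod ≠ 0) : (s.map F).prod = F s.prod := by
  induction s using Multiset.induction with
  | empty => simp [h1]
  | cons a s ih =>
    rw [Multiset.prod_cons] at hs
    have h0 := right_ne_zero_of_mul hs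
    rw [Multiset.map_cons, Multiset.prod_cons, Multiset.prod_cons,
      hmul _ _ (left_ne_zero_of_mul hs) h0, ih h0]

end Counting

/-! ### Units are monomials -/

section Units

variable {R G B : Type*} [CommRing R] [IsDomain R] [AddCommMonoid G] [AddCommGroup B]
  [LinearOrder B] [IsOrderedAddMonoid B]

/-- In `f * g = 1` the top and bottom exponents of the product coincide, which forces those of `f`
to coincide. -/
theorem exists_eq_single_of_isUnit {D : G →+ B} (hD : Function.Injective D)
    {f : AddMonoidAlgebra R G} (hf : IsUnit f) :
    ∃ x c, c ≠ 0 ∧ f = AddMonoidAlgebra.single x c := by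
  have := isDomain_addMonoidAlgebra (R := R) hD
  have hD' : Function.Injective (-D) := fun x y h ↦ hD (neg_injective h)
  obtain ⟨g, hg⟩ := hf.exists_right_inv
  have hf0 : f ≠ 0 := hf.ne_zero
  have hg0 : g ≠ 0 := by rintro rfl; simp at hg
  have hp := isStrictMax_leadExp hD hf0
  have hp' := isStrictMax_leadExp hD' hf0
  have hq := isStrictMax_leadExp hD hg0
  have hq' := isStrictMax_leadExp hD' hg0
  have h1 : leadExp D f + leadExp D g = leadExp (-D) f + leadExp (-D) g := by
    rw [← leadExp_mul hD hf0 hg0, ← leadExp_mul hD' hf0 hg0, hg, AddMonoidAlgebra.one_def,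
      leadExp_single D _ one_ne_zero, leadExp_single (-D) _ one_ne_zero]
  have h2 := congrArg D h1
  rw [map_add, map_add] at h2
  have h3 : D (leadExp D f) = D (leadExp (-D) f) :=
    le_antisymm (by
      by_contra! h
      exact (add_lt_add_of_lt_of_le h (hq.le hq'.1)).ne h2.symm) (hp.le hp'.1)
  refine ⟨leadExp D f, leadCoeff D f, hp.1, ?_⟩
  ext y
  by_cases hy : f.coeff y = 0
  · by_cases hyp : leadExp D f = y
    · rw [← hyp] at hy
      exact absurd hy hp.1
    · simp [hy, Ne.symm hyp]
  · have h4 := hp.le hy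
    have h5 : D (leadExp (-D) f) ≤ D y := neg_le_neg_iff.1 (hp'.le hy)
    have : leadExp D f = y := hD (le_antisymm (h3 ▸ h5) h4)
    subst this
    simp [leadCoeff]

end Units

/-! ### The embedding into a group algebra over a field -/

section Embedding

variable {R K M G : Type*} [CommRing R] [Field K] [Algebra R K]
  [AddCommMonoid M] [AddCommGroup G]

/-- The map `R[M] → K[G]` induced by `R → K` and `M → G`. -/
noncomputable def embed (R K : Type*) [CommRing R] [Field K] [Algebra R K] (j : M →+ G) :
    AddMonoidAlgebra R M →+* AddMonoidAlgebra K G :=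
  (AddMonoidAlgebra.mapDomainRingHom K j).comp (AddMonoidAlgebra.mapRingHom M (algebraMap R K))

theorem embed_single (j : M →+ G) (m : M) (c : R) :
    embed R K j (AddMonoidAlgebra.single m c) =
      AddMonoidAlgebra.single (j m) (algebraMap R K c) := by
  simp [embed]

theorem coeff_embed {j : M →+ G} (hj : Function.Injective j) (f : AddMonoidAlgebra R M) (m : M) :
    (embed R K j f).coeff (j m) = algebraMap R K (f.coeff m) := by
  induction f using AddMonoidAlgebra.induction_linear with
  | zero => simp
  | add x y hx hy => simp [hx, hy]
  | single n c =>
    classical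
    rw [embed_single]
    simp only [AddMonoidAlgebra.coeff_single, Finsupp.single_apply, hj.eq_iff]
    split_ifs <;> simp

theorem exists_of_coeff_embed_ne_zero {j : M →+ G} (f : AddMonoidAlgebra R M) {x : G}
    (hx : (embed R K j f).coeff x ≠ 0) : ∃ m, j m = x := by
  classical
  by_contra! h
  refine hx ?_
  clear hx
  induction f using AddMonoidAlgebra.induction_linear with
  | zero => simp
  | add y z hy hz => simp [hy, hz]
  | single n c =>
    rw [embed_single]
    simp [h n]

variable [FaithfulSMul R K]

theorem embed_injective {j : M →+ G} (hj : Function.Injective j) :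
    Function.Injective (embed R K j) := by
  intro f g h
  ext m
  apply FaithfulSMul.algebraMap_injective R K
  rw [← coeff_embed hj, ← coeff_embed hj, h]

variable {B : Type*} [AddCommGroup B] [LinearOrder B]

theorem IsStrictMax.embed {j : M →+ G} (hj : Function.Injective j) {D : G →+ B}
    {f : AddMonoidAlgebra R M} {p : M} (hp : IsStrictMax (D.comp j) f p) :
    IsStrictMax D (embed R K j f) (j p) := by
  refine ⟨?_, fun a ha hne ↦ ?_⟩
  · rw [coeff_embed hj, Ne, map_eq_zero_iff _ (FaithfulSMul.algebraMap_injective R K)]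
    exact hp.1
  · obtain ⟨m, rfl⟩ := exists_of_coeff_embed_ne_zero f ha
    rw [coeff_embed hj, Ne, map_eq_zero_iff _ (FaithfulSMul.algebraMap_injective R K)] at ha
    exact hp.2 m ha fun h ↦ hne (by rw [h])

end Embedding

/-! ### From coefficients and exponents up to the monoid ring -/

section Ascent

variable {R M G : Type*} [CommRing R] [AddCommMonoid M] [AddCommGroup G]
  [IsAddTorsionFree G]

theorem isUnit_single_of_isUnit {m : M} {c : R} (hm : IsUnit (Multiplicative.ofAdd m))
    (hc : IsUnit c) : IsUnit (AddMonoidAlgebra.single m c) := by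
  obtain ⟨n, hn⟩ := hm.exists_right_inv
  obtain ⟨d, hd⟩ := hc.exists_right_inv
  refine IsUnit.of_mul_eq_one (AddMonoidAlgebra.single n.toAdd d) ?_
  have hn' : m + n.toAdd = 0 := congrArg Multiplicative.toAdd hn
  rw [AddMonoidAlgebra.single_mul_single, hn', hd, AddMonoidAlgebra.one_def]

variable [IsDomain R]

theorem isBFD_addMonoidAlgebra (hG : ∀ b : G, b ≠ 0 → HasTypeZero b) {j : M →+ G}
    (hj : Function.Injective j) (hR : IsBFD R) (hM : IsBFM (Multiplicative M)) :
    IsBFD (AddMonoidAlgebra R M) := by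
  classical
  obtain ⟨B, _, _, _, D, hD⟩ := exists_injective_hom_ordered G
  have hE : Function.Injective (D.comp j) := hD.comp hj
  have := isDomain_addMonoidAlgebra (R := R) hE
  let K := FractionRing R
  have hψ := embed_injective (R := R) (K := K) hj
  rw [isBFD_iff] at hR ⊢
  rw [isBFM_iff] at hM
  intro f hf
  let lc : AddMonoidAlgebra R M → R := leadCoeff (D.comp j)
  let le : AddMonoidAlgebra R M → Multiplicative M := fun g ↦ .ofAdd (leadExp (D.comp j) g)
  obtain ⟨N₁, h₁⟩ := (hR (lc f) (leadCoeff_ne_zero hE hf)).exists_countP_le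
  obtain ⟨N₂, h₂⟩ := (hM (le f)).exists_countP_le
  obtain ⟨N₃, h₃⟩ := (hasBoundedLength_of_hasTypeZero (K := K) hG
    ((map_ne_zero_iff _ hψ).2 hf)).exists_countP_le
  refine ⟨N₁ + N₂ + N₃, fun s hs hp ↦ ?_⟩
  have e₁ := h₁ (s.map lc) <| by
    rw [map_multiset_prod_of_ne_zero lc (leadCoeff_single _ _ one_ne_zero)
      (fun f g ↦ leadCoeff_mul hE) s (by rwa [hp]), hp]
  have e₂ := h₂ (s.map le) <| by
    rw [map_multiset_prod_of_ne_zero le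
      (congrArg Multiplicative.ofAdd (leadExp_single _ _ one_ne_zero))
      (fun f g hf hg ↦ congrArg Multiplicative.ofAdd (leadExp_mul hE hf hg)) s (by rwa [hp]), hp]
  have e₃ := h₃ (s.map (embed R K j)) (by rw [← hp, map_multiset_prod])
  rw [Multiset.countP_map, ← Multiset.countP_eq_card_filter] at e₁ e₂ e₃
  -- Each non-unit factor has a non-unit among its leading coefficient, leading exponent and image
  -- in `K[G]`.
  refine (card_le_countP_add _ _ _ s fun a ha ↦ ?_).trans (by gcongr)
  by_contra! hu
  obtain ⟨x, c, hc, hxc⟩ := exists_eq_single_of_isUnit hD hu.2.2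
  have ha0 : a ≠ 0 := by
    rintro rfl
    exact hf (by rw [← hp]; exact Multiset.prod_eq_zero ha)
  have hmax := isStrictMax_leadExp hE ha0
  have hx : j (leadExp (D.comp j) a) = x := by
    have h := (hmax.embed (K := K) hj).leadExp_eq
    rw [hxc, leadExp_single D x hc] at h
    exact h.symm
  apply hs a ha
  have : a = AddMonoidAlgebra.single (leadExp (D.comp j) a) (lc a) := by
    apply hψ
    rw [embed_single, hx]
    have h := coeff_embed (K := K) hj a (leadExp (D.comp j) a)
    rw [hxc, hx, AddMonoidAlgebra.coeff_single, Finsupp.single_eq_same] at h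
    rw [hxc, h]; rfl
  rw [this]
  exact isUnit_single_of_isUnit hu.2.1 hu.1

theorem isFFD_addMonoidAlgebra [IsCancelAdd M] (hG : ∀ b : G, b ≠ 0 → HasTypeZero b) {j : M →+ G}
    (hj : Function.Injective j) (hR : IsFFD R) (hM : IsFFM (Multiplicative M)) :
    IsFFD (AddMonoidAlgebra R M) := by
  classical
  obtain ⟨B, _, _, _, D, hD⟩ := exists_injective_hom_ordered G
  have hE : Function.Injective (D.comp j) := hD.comp hj
  have := isDomain_addMonoidAlgebra (R := R) hE
  let K := FractionRing R
  have hψ := embed_injective (R := R) (K := K) hj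
  rw [isFFD_iff] at hR ⊢
  rw [isFFM_iff] at hM
  intro f hf
  let lc : AddMonoidAlgebra R M → R := leadCoeff (D.comp j)
  let le : AddMonoidAlgebra R M → Multiplicative M := fun g ↦ .ofAdd (leadExp (D.comp j) g)
  obtain ⟨T₁, hT₁, h₁⟩ := hR (lc f) (leadCoeff_ne_zero hE hf)
  obtain ⟨T₂, hT₂, h₂⟩ := hM (le f)
  obtain ⟨T₃, hT₃, h₃⟩ := hasFiniteDivisors_of_hasTypeZero (K := K) hG
    ((map_ne_zero_iff _ hψ).2 hf)
  let P : R × Multiplicative M × AddMonoidAlgebra K G → AddMonoidAlgebra R M → Prop := fun t g ↦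
    g ≠ 0 ∧ Associated t.1 (lc g) ∧ Associated t.2.1 (le g) ∧ Associated t.2.2 (embed R K j g)
  -- One representative is chosen per triple of classes; the value `0` for unrealized triples is
  -- never used.
  let F : R × Multiplicative M × AddMonoidAlgebra K G → AddMonoidAlgebra R M := fun t ↦
    if h : ∃ g, P t g then h.choose else 0
  refine ⟨F '' (T₁ ×ˢ T₂ ×ˢ T₃), (hT₁.prod (hT₂.prod hT₃)).image F, ?_⟩
  rintro g ⟨g', rfl⟩
  have hg := left_ne_zero_of_mul hf
  have hg' := right_ne_zero_of_mul hf
  obtain ⟨t₁, ht₁, a₁⟩ := h₁ (lc g) ⟨lc g', leadCoeff_mul hE hg hg'⟩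
  obtain ⟨t₂, ht₂, a₂⟩ := h₂ (le g) ⟨le g', congrArg Multiplicative.ofAdd (leadExp_mul hE hg hg')⟩
  obtain ⟨t₃, ht₃, a₃⟩ := h₃ (embed R K j g) ⟨embed R K j g', map_mul _ _ _⟩
  refine ⟨F (t₁, t₂, t₃), ⟨_, ⟨ht₁, ht₂, ht₃⟩, rfl⟩, ?_⟩
  have hex : ∃ g, P (t₁, t₂, t₃) g := ⟨g, hg, a₁, a₂, a₃⟩
  have hF : P (t₁, t₂, t₃) (F (t₁, t₂, t₃)) := by
    have : F (t₁, t₂, t₃) = hex.choose := dif_pos hex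
    rw [this]
    exact hex.choose_spec
  generalize F (t₁, t₂, t₃) = h at hF ⊢
  obtain ⟨hh, b₁, b₂, b₃⟩ := hF
  obtain ⟨u, hu⟩ := b₁.symm.trans a₁
  obtain ⟨v, hv⟩ := b₂.symm.trans a₂
  obtain ⟨w, hw⟩ := b₃.symm.trans a₃
  -- Over `K[G]` the two elements differ by a monomial; comparing leading terms identifies it with
  -- the image of this unit of `R[M]`.
  have hunit : IsUnit (AddMonoidAlgebra.single (v : Multiplicative M).toAdd (u : R)) :=
    isUnit_single_of_isUnit v.isUnit u.isUnit
  obtain ⟨x, c, hc, hxc⟩ := exists_eq_single_of_isUnit hD w.isUnit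
  have mh := (isStrictMax_leadExp hE hh).embed (K := K) hj
  have mg := (isStrictMax_leadExp hE hg).embed (K := K) hj
  have mw := isStrictMax_single D x hc
  have hv' : leadExp (D.comp j) h + (v : Multiplicative M).toAdd = leadExp (D.comp j) g :=
    congrArg Multiplicative.toAdd hv
  have hexp : x = j (v : Multiplicative M).toAdd := by
    have h1 := mh.mul mw
    rw [← hxc, hw] at h1
    have h2 := h1.unique mg
    rw [← hv', map_add] at h2
    exact add_left_cancel h2
  have hcoef : c = algebraMap R K u := by
    have h1 := mh.coeff_mul mw
    rw [← hxc, hw, hxc, hexp, ← map_add, hv', coeff_embed hj, coeff_embed hj,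
      AddMonoidAlgebra.coeff_single, Finsupp.single_eq_same] at h1
    change algebraMap R K (lc g) = algebraMap R K (lc h) * c at h1
    rw [← hu, map_mul] at h1
    refine (mul_left_cancel₀ ?_ h1).symm
    rw [Ne, map_eq_zero_iff _ (FaithfulSMul.algebraMap_injective R K)]
    exact leadCoeff_ne_zero hE hh
  obtain ⟨z, hz⟩ := hunit
  refine ⟨z, hψ ?_⟩
  rw [map_mul, hz, embed_single, ← hexp, ← hcoef, ← hxc, hw]

end Ascent

/-! ### Groups and fields -/

section Trivial

theorem isFFM_of_forall_isUnit {H : Type*} [CommMonoid H] [IsCancelMul H]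
    (h : ∀ a : H, IsUnit a) : IsFFM H :=
  isFFM_iff.2 fun _ ↦ ⟨{1}, Set.finite_singleton 1, fun d _ ↦
    ⟨1, rfl, (associated_one_iff_isUnit.2 (h d)).symm⟩⟩

theorem IsFFM.isBFM {H : Type*} [CommMonoid H] [IsCancelMul H] (h : IsFFM H) : IsBFM H :=
  isBFM_iff.2 fun b ↦ (isFFM_iff.1 h b).hasBoundedLength

theorem isFFD_field (F : Type*) [Field F] : IsFFD F :=
  isFFD_iff.2 fun _ hb ↦ ⟨{1}, Set.finite_singleton 1, fun _ hd ↦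
    ⟨1, rfl, (associated_one_iff_isUnit.2 (isUnit_of_dvd_unit hd hb.isUnit)).symm⟩⟩

theorem isBFD_field (F : Type*) [Field F] : IsBFD F :=
  have := isCancelMul_nonZeroDivisors (R := F)
  ⟨inferInstance, (isFFD_field F).2.isBFM⟩

end Trivial

/-! ### The equivalences for monoid rings -/

section Main

variable {R M G : Type*} [CommRing R] [IsDomain R] [AddCommMonoid M]
  [AddCommGroup G] [IsAddTorsionFree G]

theorem isBFD_addMonoidAlgebra_iff (hG : ∀ b : G, b ≠ 0 → HasTypeZero b) {j : M →+ G}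
    (hj : Function.Injective j) :
    IsBFD (AddMonoidAlgebra R M) ↔ IsBFD R ∧ IsBFM (Multiplicative M) := by
  refine ⟨fun h ↦ ?_, fun h ↦ isBFD_addMonoidAlgebra hG hj h.1 h.2⟩
  obtain ⟨B, _, _, _, D, hD⟩ := exists_injective_hom_ordered G
  have hE : Function.Injective (D.comp j) := hD.comp hj
  exact ⟨isBFD_of_isBFD_addMonoidAlgebra hE h, isBFM_of_isBFD_addMonoidAlgebra hE h⟩

theorem isFFD_addMonoidAlgebra_iff [IsCancelAdd M] (hG : ∀ b : G, b ≠ 0 → HasTypeZero b) {j : M →+ G}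
    (hj : Function.Injective j) :
    IsFFD (AddMonoidAlgebra R M) ↔ IsFFD R ∧ IsFFM (Multiplicative M) := by
  refine ⟨fun h ↦ ?_, fun h ↦ isFFD_addMonoidAlgebra hG hj h.1 h.2⟩
  obtain ⟨B, _, _, _, D, hD⟩ := exists_injective_hom_ordered G
  have hE : Function.Injective (D.comp j) := hD.comp hj
  exact ⟨isFFD_of_isFFD_addMonoidAlgebra hE h, isFFM_of_isFFD_addMonoidAlgebra hE h⟩

end Main

end FactorizationTheory

theorem mainTheorem11
    (R : Type*) [CommRing R] [IsDomain R]
    (F : Type*) [Field F]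
    (G : Type*) [AddCommGroup G] [IsAddTorsionFree G]
    (hG : ∀ b : G, b ≠ 0 → FactorizationTheory.HasTypeZero b)
    (M : Type*) [AddCancelCommMonoid M] [IsAddTorsionFree M]
    (hM : ∀ b : Algebra.GrothendieckAddGroup M, b ≠ 0 → FactorizationTheory.HasTypeZero b) :
    ((FactorizationTheory.IsBFD (AddMonoidAlgebra R G) ↔ FactorizationTheory.IsBFD R) ∧
      (FactorizationTheory.IsBFD (AddMonoidAlgebra F M) ↔
        FactorizationTheory.IsBFM (Multiplicative M)) ∧
      (FactorizationTheory.IsBFD (AddMonoidAlgebra R M) ↔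
        FactorizationTheory.IsBFD R ∧ FactorizationTheory.IsBFM (Multiplicative M))) ∧
    ((FactorizationTheory.IsFFD (AddMonoidAlgebra R G) ↔ FactorizationTheory.IsFFD R) ∧
      (FactorizationTheory.IsFFD (AddMonoidAlgebra F M) ↔
        FactorizationTheory.IsFFM (Multiplicative M)) ∧
      (FactorizationTheory.IsFFD (AddMonoidAlgebra R M) ↔
        FactorizationTheory.IsFFD R ∧ FactorizationTheory.IsFFM (Multiplicative M))) := by
  -- In a group every element is a unit, so for `R[G]` the condition on exponents is void; for
  -- `F[M]` the one on coefficients is.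
  have hGF : FactorizationTheory.IsFFM (Multiplicative G) :=
    FactorizationTheory.isFFM_of_forall_isUnit fun a ↦ Group.isUnit a
  have hid : Function.Injective (AddMonoidHom.id G) := Function.injective_id
  have hof : Function.Injective (Algebra.GrothendieckAddGroup.of (M := M)) :=
    Algebra.GrothendieckAddGroup.of_injective
  refine ⟨⟨?_, ?_, FactorizationTheory.isBFD_addMonoidAlgebra_iff hM hof⟩,
    ?_, ?_, FactorizationTheory.isFFD_addMonoidAlgebra_iff hM hof⟩
  · rw [FactorizationTheory.isBFD_addMonoidAlgebra_iff hG hid, and_iff_left hGF.isBFM]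
  · rw [FactorizationTheory.isBFD_addMonoidAlgebra_iff hM hof,
      and_iff_right (FactorizationTheory.isBFD_field F)]
  · rw [FactorizationTheory.isFFD_addMonoidAlgebra_iff hG hid, and_iff_left hGF]
  · rw [FactorizationTheory.isFFD_addMonoidAlgebra_iff hM hof,
      and_iff_right (FactorizationTheory.isFFD_field F)]
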